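/- Let $n\ge 1$ be an integer. Write $(x)_{(k)}=\Gamma(x+k)/\Gamma(x)$, and for a weight $w$ on an interval $I\subset\mathbb R$ and an integer $k$ put $$M_{w}(k,n)=\frac1C\int_{I^n}\Bigl(\sum_{j=1}^n x_j^k\Bigr)\prod_{j=1}^n w(x_j)\prod_{1\le i<j\le n}|x_j-x_i|^2\,dx_1\cdots dx_n,\qquad C=\int_{I^n}\prod_{j=1}^n w(x_j)\prod_{1\le i<j\le n}|x_j-x_i|^2\,dx_1\cdots dx_n .$$ Let $M^{(2)}_{\mathrm J_{a,b}}(k,n)$ and $M^{(2)}_{\mathrm L_b}(k,n)$ denote this moment for the Jacobi weight $x^b(1-x)^a$ on $[0,1]$ and the Laguerre weight $x^be^{-x}$ on $[0,\infty)$. (i) Let $m\ge n$ and $k\ge1$ be integers and $\delta>-2$ real. For $\beta=2$ the transmission eigenvalues $T_1,\dots,T_n\in[0,1]$ have joint density proportional to $\prod_{j}T_j^{m-n}(1-T_j)^{\delta/2}\prod_{i<j}|T_j-T_i|^2$, and $\langle\mathcal T^{(2,\delta)}_{k,n,m}\rangle=\langle\sum_j T_j^k\rangle$. This density is integrable with positive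 total mass, the integral defining the moment converges absolutely, and $$\bigl\langle\mathcal T^{(2,\delta)}_{k,n,m}\bigr\rangle=M^{(2)}_{\mathrm J_{\delta/2,\,m-n}}(k,n)=\frac{nm}{\delta/2+n+m}-\sum_{j=1}^{k-1}\frac1j\sum_{i=1}^{\min(j,n)}\binom ji\binom j{i-1}\,\mathcal U^{m,n,\delta}_{i,j},$$ where $$\mathcal U^{m,n,\delta}_{i,j}=\frac{(\delta/2+m+n-2i+j+1)\,(\delta/2+m)_{(j-i+1)}\,(m)_{(j-i+1)}}{(\delta/2+m+n-i)_{(j+2)}\,(\delta/2+m+n-i+1)_{(j)}\,(\delta/2+n+1)_{(-i)}\,(n+1)_{(-i)}} .$$ (ii) Let $k$ be an integer with $1\le k<n+1$. For $\beta=2$ the inverses $\gamma_j=\tau_j^{-1}\in[0,\infty)$ of the proper delay times $\tau_1,\dots,\tau_n$ (in units where the Heisenberg time equals $n$) have joint density proportional to $\prod_j\gamma_j^{n}e^{-n\gamma_j}\prod_{i<j}|\gamma_j-\gamma_i|^2$, and $\langle\mathcal D^{(2)}_{k,n}\rangle=\frac1n\langle\sum_j\tau_j^k\rangle$. This density is integrable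 with positive total mass, the integral defining the moment converges absolutely, and $$\bigl\langle\mathcal D^{(2)}_{k,n}\bigr\rangle=n^{k-1}M^{(2)}_{\mathrm L_{n}}(-k,n)=\frac{n^{k-1}}k\sum_{j=0}^{n-1}\binom{k+j-1}{k-1}\binom{k+j}{k-1}\frac{(2n)_{(-k-j)}}{(n+1)_{(-j-1)}} .$$ -/

import Mathlib

open MeasureTheory

noncomputable section

namespace QuantumTransport

/-- The Pochhammer symbol with arbitrary real increment,
`(x)_{(k)} = Γ(x + k) / Γ(x)`. -/
def poch (x k : ℝ) : ℝ := Real.Gamma (x + k) / Real.Gamma x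

/-- The unnormalised joint density of the eigenvalues of a `β`-ensemble with one-particle
weight `w`: `∏ⱼ w(xⱼ) ∏_{j<k} |x_k - x_j|^β`. -/
def jointDensity (β : ℝ) (w : ℝ → ℝ) (n : ℕ) (x : Fin n → ℝ) : ℝ :=
  (∏ j, w (x j)) * ∏ j, ∏ k ∈ Finset.Ioi j, |x k - x j| ^ β

/-- The domain `Iⁿ` of the eigenvalues. -/
def cube (I : Set ℝ) (n : ℕ) : Set (Fin n → ℝ) := Set.univ.pi fun _ => I

/-- The normalisation constant `C` of the joint density on `Iⁿ`. -/
def normConst (β : ℝ) (w : ℝ → ℝ) (I : Set ℝ) (n : ℕ) : ℝ :=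
  ∫ x in cube I n, jointDensity β w n x

/-- The `k`-th moment of the eigenvalue density (normalised to `n`), `k` any integer:
`(1/C) ∫_{Iⁿ} (∑ⱼ xⱼ^k) ∏ⱼ w(xⱼ) ∏_{j<k} |x_k - x_j|^β dx`. -/
def ensembleMoment (β : ℝ) (w : ℝ → ℝ) (I : Set ℝ) (k : ℤ) (n : ℕ) : ℝ :=
  (1 / normConst β w I n) * ∫ x in cube I n, (∑ j, x j ^ k) * jointDensity β w n x

/-- The ensemble is well defined (its joint density is integrable with positive mass) and its
`k`-th moment exists as an absolutely convergent integral. -/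
def MomentExists (β : ℝ) (w : ℝ → ℝ) (I : Set ℝ) (k : ℤ) (n : ℕ) : Prop :=
  IntegrableOn (jointDensity β w n) (cube I n) ∧
    0 < normConst β w I n ∧
    IntegrableOn (fun x => (∑ j, x j ^ k) * jointDensity β w n x) (cube I n)

/-- Weight of the Laguerre ensemble `L_b`, on `[0, ∞)`. -/
def laguerreWeight (β b : ℝ) (x : ℝ) : ℝ :=
  x ^ (β / 2 * (b + 1) - 1) * Real.exp (-(β * x / 2))

/-- Weight of the Jacobi ensemble `J_{a,b}`, on `[0, 1]`. -/
def jacobiWeight (β a b : ℝ) (x : ℝ) : ℝ :=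
  x ^ (β / 2 * (b + 1) - 1) * (1 - x) ^ (β / 2 * (a + 1) - 1)

/-- The moments `M_{L_b}^{(β)}(k, n)` of the Laguerre ensemble. -/
def laguerreMoment (β b : ℝ) (k : ℤ) (n : ℕ) : ℝ :=
  ensembleMoment β (laguerreWeight β b) (Set.Ici 0) k n

/-- The moments `M_{J_{a,b}}^{(β)}(k, n)` of the Jacobi ensemble. -/
def jacobiMoment (β a b : ℝ) (k : ℤ) (n : ℕ) : ℝ :=
  ensembleMoment β (jacobiWeight β a b) (Set.Icc 0 1) k n

/-- Weight in the joint density of the transmission eigenvalues `T₁, …, Tₙ ∈ [0, 1]`: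
`T^α (1 - T)^{δ/2}` with `α = (β/2)(m - n + 1) - 1`. -/
def transmissionWeight (β δ : ℝ) (n m : ℕ) (T : ℝ) : ℝ :=
  T ^ (β / 2 * ((m : ℝ) - n + 1) - 1) * (1 - T) ^ (δ / 2)

/-- The moments `⟨T_{k,n,m}^{(β,δ)}⟩ = ⟨T₁^k + ⋯ + Tₙ^k⟩` of the transmission eigenvalues. -/
def transmissionMoment (β δ : ℝ) (k n m : ℕ) : ℝ :=
  ensembleMoment β (transmissionWeight β δ n m) (Set.Icc 0 1) k n

/-- Weight in the joint density of the inverse delay times `γⱼ = 1/τⱼ ∈ [0, ∞)`: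
`γ^{nβ/2} e^{-β τ_H γ / 2}`, with Heisenberg time `τ_H = n`. -/
def inverseDelayWeight (β : ℝ) (n : ℕ) (γ : ℝ) : ℝ :=
  γ ^ ((n : ℝ) * β / 2) * Real.exp (-(β * n * γ / 2))

/-- The moments `⟨D_{k,n}^{(β)}⟩ = (1/n) ⟨τ₁^k + ⋯ + τₙ^k⟩` of the proper delay times
`τⱼ = 1/γⱼ`, i.e. `τⱼ^k = γⱼ^{-k}`. -/
def delayMoment (β : ℝ) (k n : ℕ) : ℝ :=
  (1 / (n : ℝ)) * ensembleMoment β (inverseDelayWeight β n) (Set.Ici 0) (-(k : ℤ)) n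

/-- The coefficients `U^{m,n,δ}_{i,j}`. -/
def coeffU (m n : ℕ) (δ : ℝ) (i j : ℕ) : ℝ :=
  ((δ / 2 + m + n - 2 * i + j + 1) * poch (δ / 2 + m) ((j : ℝ) - i + 1)
      * poch m ((j : ℝ) - i + 1)) /
    (poch (δ / 2 + m + n - i) ((j : ℝ) + 2) * poch (δ / 2 + m + n - i + 1) j
      * poch (δ / 2 + n + 1) (-(i : ℝ)) * poch ((n : ℝ) + 1) (-(i : ℝ)))

end QuantumTransport

end

namespace QuantumTransport

open Polynomial

/-! For `β = 2` the squared Vandermonde determinant equals `det (p_j(x_i))^2` for the monic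
orthogonal polynomials `p_i` of the weight `w`, with squared norms `h_i`. Expanding over pairs of
permutations and integrating, orthogonality leaves only equal pairs: the mass is `n! ∏ h_i`, and the
`k`-th moment is `S(k) = ∑_{i<n} (1/h_i) ∫ x^k p_i^2 w` (`momentExists_and_ensembleMoment_eq`).

The Jacobi and Laguerre weights satisfy a Pearson equation `(σ w)' = τ w`. The operator `D q = τ q +
2 σ q'` is antisymmetric for `w` and raises degrees by at most one, so `D p_i` involves only
`p_{i+1}` and `p_{i-1}`. Since `(D p_i) p_i w = (σ w p_i^2)'`, the sum of `(σ w p_i^2)' / h_i`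
telescopes to a multiple of `p_{n+1} p_n w` (`sum_skewOp`, with `n + 1` polynomials). Testing
against a power of `x` and integrating by parts turns the left side into moments.

In the Jacobi case this evaluates `k (S(k) - S(k+1))` (`jacobiS_succ`), while `S(1)` is read off
from a subleading coefficient. In the Laguerre case `σ = x`, and testing against `x^(-k)` yields `k
S(-k)` at once (`laguerre_sum`). On the right side the power of `x` shifts the parameter of the
weight; expanding both polynomials in those orthogonal for the shifted weight (`jacobiP_expansion`,
`laguerreP_expansion`) leaves a single sum. The rest is Gamma-function algebra (`coeffU_eq`) and,
for delay times, the dilation `x ↦ n x` (`ensembleMoment_scale`). -/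

/-- The linear functional on real polynomials with prescribed moments. -/
noncomputable def momentFunctional (μ : ℕ → ℝ) : ℝ[X] →ₗ[ℝ] ℝ :=
  Polynomial.lsum fun k => μ k • LinearMap.id

@[simp] theorem momentFunctional_monomial (μ : ℕ → ℝ) (k : ℕ) (c : ℝ) :
    momentFunctional μ (monomial k c) = c * μ k := by
  simp [momentFunctional, Polynomial.lsum_apply, mul_comm]

theorem linearMap_eq_of_monomial {L L' : ℝ[X] →ₗ[ℝ] ℝ}
    (h : ∀ k : ℕ, L (monomial k 1) = L' (monomial k 1)) : L = L' := by
  apply Polynomial.lhom_ext'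
  intro k
  ext
  simpa using h k

/-! ### Orthogonal polynomials of a functional with a Pearson equation -/

/-- `p` is the sequence of monic orthogonal polynomials of `L`, with squared norms `h`. -/
structure IsMonicOrthogonal (L : ℝ[X] →ₗ[ℝ] ℝ) (p : ℕ → ℝ[X]) (h : ℕ → ℝ) : Prop where
  natDegree_le : ∀ n, (p n).natDegree ≤ n
  coeff_self : ∀ n, (p n).coeff n = 1
  apply_mul : ∀ n q, q.natDegree ≤ n → L (p n * q) = q.coeff n * h n
  norm_pos : ∀ n, 0 < h n

/-- The Pearson equation `(σ w)' = τ w`, in terms of the moment functional of the weight `w`. -/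
def IsPearson (L : ℝ[X] →ₗ[ℝ] ℝ) (σ τ : ℝ[X]) : Prop :=
  ∀ q, L (τ * q + σ * derivative q) = 0

/-- The first-order operator that is antisymmetric for a weight with `(σ w)' = τ w`. -/
noncomputable def skewOp (σ τ q : ℝ[X]) : ℝ[X] := τ * q + 2 * σ * derivative q

/-- The leading coefficient of `skewOp σ τ` on monic polynomials of degree `n`. -/
noncomputable def skewCoeff (σ τ : ℝ[X]) (n : ℕ) : ℝ := τ.coeff 1 + 2 * n * σ.coeff 2

theorem natDegree_sub_le_of_le_of_le {q r : ℝ[X]} {n : ℕ} (hq : q.natDegree ≤ n)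
    (hr : r.natDegree ≤ n) : (q - r).natDegree ≤ n :=
  (natDegree_sub_le q r).trans (max_le hq hr)

theorem natDegree_skewOp_le {σ τ q : ℝ[X]} {n : ℕ} (hσ : σ.natDegree ≤ 2)
    (hτ : τ.natDegree ≤ 1) (hq : q.natDegree ≤ n) : (skewOp σ τ q).natDegree ≤ n + 1 := by
  -- Constants are separate: the bound `n - 1` on the degree of the derivative truncates at `0`, and
  -- `σ` alone may have degree `2`.
  rcases Nat.eq_zero_or_pos n with rfl | hn
  · obtain ⟨c, rfl⟩ := natDegree_eq_zero.1 (Nat.le_zero.1 hq)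
    simp only [skewOp, derivative_C, mul_zero, add_zero]
    exact (natDegree_mul_C_le _ _).trans (by simpa using hτ)
  · refine natDegree_add_le_of_degree_le ?_ ?_
    · exact natDegree_mul_le.trans (by omega)
    · have h1 := natDegree_derivative_le q
      have h2 : (2 * σ : ℝ[X]).natDegree ≤ 2 := by
        have : (2 * σ : ℝ[X]) = C 2 * σ := by rw [map_ofNat]
        rw [this]; exact (natDegree_C_mul_le _ _).trans hσ
      exact natDegree_mul_le.trans (by omega)

theorem coeff_skewOp {σ τ q : ℝ[X]} {n : ℕ} (hσ : σ.natDegree ≤ 2)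
    (hτ : τ.natDegree ≤ 1) (hq : q.natDegree ≤ n) :
    (skewOp σ τ q).coeff (n + 1) = skewCoeff σ τ n * q.coeff n := by
  have e2 : (2 * σ * derivative q : ℝ[X]) = C 2 * (σ * derivative q) := by
    rw [map_ofNat, mul_assoc]
  rcases Nat.eq_zero_or_pos n with rfl | hn
  · obtain ⟨c, rfl⟩ := natDegree_eq_zero.1 (Nat.le_zero.1 hq)
    simp [skewOp, skewCoeff]
  · obtain ⟨m, rfl⟩ : ∃ m, n = m + 1 := ⟨n - 1, by omega⟩
    have h1 := natDegree_derivative_le q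
    rw [skewOp, e2, coeff_add, coeff_C_mul, add_comm (m + 1) 1, coeff_mul_add_eq_of_natDegree_le hτ hq,
      show 1 + (m + 1) = 2 + m by ring, coeff_mul_add_eq_of_natDegree_le hσ (by omega),
      coeff_derivative, skewCoeff]
    push_cast
    ring

/-- The two sides differ by twice the Pearson equation applied to the product `p * q`. -/
theorem IsPearson.skew {L : ℝ[X] →ₗ[ℝ] ℝ} {σ τ : ℝ[X]} (H : IsPearson L σ τ) (p q : ℝ[X]) :
    L (skewOp σ τ p * q) = -L (p * skewOp σ τ q) := by
  have h := H (p * q)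
  have e : skewOp σ τ p * q + p * skewOp σ τ q
      = (2 : ℝ) • (τ * (p * q) + σ * derivative (p * q)) := by
    simp only [skewOp, derivative_mul, smul_eq_C_mul, map_ofNat]
    ring
  have := congrArg L e
  rw [map_add, map_smul, h] at this
  simp only [smul_zero] at this
  linarith

namespace IsMonicOrthogonal

variable {L : ℝ[X] →ₗ[ℝ] ℝ} {p : ℕ → ℝ[X]} {h : ℕ → ℝ}

theorem apply_mul_eq_zero (H : IsMonicOrthogonal L p h) {n : ℕ} {q : ℝ[X]}
    (hq : q.natDegree < n) : L (p n * q) = 0 := by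
  rw [H.apply_mul n q hq.le, coeff_eq_zero_of_natDegree_lt hq, zero_mul]

theorem apply_self (H : IsMonicOrthogonal L p h) (n : ℕ) : L (p n * p n) = h n := by
  rw [H.apply_mul n _ (H.natDegree_le n), H.coeff_self, one_mul]

theorem apply_mul_of_ne (H : IsMonicOrthogonal L p h) {i j : ℕ} (hij : i ≠ j) :
    L (p i * p j) = 0 := by
  rcases lt_or_gt_of_ne hij with hlt | hlt
  · rw [mul_comm]; exact H.apply_mul_eq_zero ((H.natDegree_le i).trans_lt hlt)
  · exact H.apply_mul_eq_zero ((H.natDegree_le j).trans_lt hlt)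

theorem monic (H : IsMonicOrthogonal L p h) (n : ℕ) : (p n).Monic :=
  monic_of_natDegree_le_of_coeff_eq_one n (H.natDegree_le n) (H.coeff_self n)

theorem natDegree_eq (H : IsMonicOrthogonal L p h) (n : ℕ) : (p n).natDegree = n :=
  le_antisymm (H.natDegree_le n)
    (le_natDegree_of_ne_zero (by rw [H.coeff_self]; exact one_ne_zero))

theorem eq_zero_of_apply (H : IsMonicOrthogonal L p h) {r : ℝ[X]}
    (hr : ∀ d ≤ r.natDegree, L (p d * r) = 0) : r = 0 := by
  have := hr _ le_rfl
  rw [H.apply_mul _ _ le_rfl] at this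
  rcases mul_eq_zero.1 this with h0 | h0
  · exact leadingCoeff_eq_zero.1 h0
  · exact absurd h0 (H.norm_pos _).ne'

theorem natDegree_le_of_succ {r : ℝ[X]} {n : ℕ} (h1 : r.natDegree ≤ n + 1)
    (h2 : r.coeff (n + 1) = 0) : r.natDegree ≤ n := by
  rw [natDegree_le_iff_coeff_eq_zero] at h1 ⊢
  intro m hm
  rcases eq_or_lt_of_le (Nat.succ_le_of_lt hm) with rfl | hlt
  · exact h2
  · exact h1 m hlt

/-- Multiplying the weight by `x` changes the monic orthogonal polynomials by one lower term. -/
theorem connection (H : IsMonicOrthogonal L p h) {L' : ℝ[X] →ₗ[ℝ] ℝ} {p' : ℕ → ℝ[X]}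
    {h' : ℕ → ℝ} (H' : IsMonicOrthogonal L' p' h') (hL : ∀ q, L' q = L (X * q)) (n : ℕ) :
    p (n + 1) = p' (n + 1) + C (h (n + 1) / h' n) * p' n := by
  rw [← sub_eq_zero]
  set r := p (n + 1) - (p' (n + 1) + C (h (n + 1) / h' n) * p' n) with hr
  have h1 : r.natDegree ≤ n + 1 := by
    refine natDegree_sub_le_of_le_of_le (H.natDegree_le _) (natDegree_add_le_of_degree_le
      (H'.natDegree_le _) ((natDegree_C_mul_le _ _).trans ((H'.natDegree_le n).trans n.le_succ)))
  have h2 : r.coeff (n + 1) = 0 := by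
    have : (p' n).coeff (n + 1) = 0 :=
      coeff_eq_zero_of_natDegree_lt ((H'.natDegree_le n).trans_lt n.lt_succ_self)
    simp [hr, H.coeff_self, H'.coeff_self, this]
  have h3 := natDegree_le_of_succ h1 h2
  -- Against `p' d` the functional `L'` sees `L (p (n + 1) * (X * p' d))`, which vanishes unless `X
  -- * p' d` reaches degree `n + 1`, that is, unless `d = n`.
  refine H'.eq_zero_of_apply fun d hd => ?_
  have hdn : d ≤ n := hd.trans h3
  have e : p' d * r = p' d * p (n + 1) - (p' d * p' (n + 1) + (h (n + 1) / h' n) • (p' d * p' n)) := by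
    rw [hr, smul_eq_C_mul]; ring
  have e1 : L' (p' d * p (n + 1)) = (p' d).coeff n * h (n + 1) := by
    rw [hL, show X * (p' d * p (n + 1)) = p (n + 1) * (p' d * X) by ring,
      H.apply_mul _ _ (natDegree_mul_le.trans ?_), coeff_mul_X]
    have := H'.natDegree_le d
    have := natDegree_X_le (R := ℝ)
    omega
  rw [e, map_sub, map_add, map_smul, e1, H'.apply_mul_of_ne (by omega : d ≠ n + 1), zero_add,
    smul_eq_mul, mul_comm (p' d), H'.apply_mul n _ ((H'.natDegree_le d).trans hdn)]
  have := (H'.norm_pos n).ne'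
  field_simp
  ring

/-- Moving the operator onto `p d` gives a polynomial of degree at most `d + 1`, orthogonal to `p (n
+ 1)` when `d < n`. Only the components along `p (n + 2)` and `p n` survive. -/
theorem skewOp_succ (H : IsMonicOrthogonal L p h) {σ τ : ℝ[X]} (hP : IsPearson L σ τ)
    (hσ : σ.natDegree ≤ 2) (hτ : τ.natDegree ≤ 1) (n : ℕ) :
    skewOp σ τ (p (n + 1)) = C (skewCoeff σ τ (n + 1)) * p (n + 2)
      - C (skewCoeff σ τ n * h (n + 1) / h n) * p n := by
  rw [← sub_eq_zero]
  set r := skewOp σ τ (p (n + 1)) - (C (skewCoeff σ τ (n + 1)) * p (n + 2)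
      - C (skewCoeff σ τ n * h (n + 1) / h n) * p n) with hr
  have hn0 : (p n).coeff (n + 2) = 0 :=
    coeff_eq_zero_of_natDegree_lt ((H.natDegree_le n).trans_lt (by omega))
  have h1 : r.natDegree ≤ n + 1 + 1 := by
    refine natDegree_sub_le_of_le_of_le (natDegree_skewOp_le hσ hτ (H.natDegree_le _)) ?_
    refine natDegree_sub_le_of_le_of_le ((natDegree_C_mul_le _ _).trans (H.natDegree_le _))
      ((natDegree_C_mul_le _ _).trans ((H.natDegree_le n).trans (by omega)))
  have h2 : r.coeff (n + 1 + 1) = 0 := by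
    rw [hr, coeff_sub, coeff_skewOp hσ hτ (H.natDegree_le _), coeff_sub, coeff_C_mul, coeff_C_mul,
      H.coeff_self, H.coeff_self, hn0]
    ring
  have h3 := natDegree_le_of_succ h1 h2
  refine H.eq_zero_of_apply fun d hd => ?_
  have hdn : d ≤ n + 1 := hd.trans h3
  have e : p d * r = p d * skewOp σ τ (p (n + 1)) - (skewCoeff σ τ (n + 1) • (p d * p (n + 2))
      - (skewCoeff σ τ n * h (n + 1) / h n) • (p d * p n)) := by
    rw [hr, smul_eq_C_mul, smul_eq_C_mul]; ring
  have hsk : L (p d * skewOp σ τ (p (n + 1))) = -L (p (n + 1) * skewOp σ τ (p d)) := by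
    rw [mul_comm, hP.skew]
  rw [e, map_sub, map_sub, map_smul, map_smul, H.apply_mul_of_ne (by omega : d ≠ n + 2), hsk]
  rcases eq_or_lt_of_le hdn with rfl | hlt
  · have := hP.skew (p (n + 1)) (p (n + 1))
    rw [mul_comm] at this
    rw [H.apply_mul_of_ne (by omega : n + 1 ≠ n)]
    simp only [smul_zero, sub_zero, sub_self]
    linarith
  · have hdn' : d ≤ n := by omega
    rw [mul_comm (p d), H.apply_mul n _ ((H.natDegree_le d).trans hdn'),
      H.apply_mul (n + 1) _ (natDegree_skewOp_le hσ hτ ((H.natDegree_le d).trans hdn')),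
      coeff_skewOp hσ hτ ((H.natDegree_le d).trans hdn')]
    have := (H.norm_pos n).ne'
    simp only [smul_eq_mul]
    field_simp
    ring

theorem skewOp_zero (H : IsMonicOrthogonal L p h) {σ τ : ℝ[X]} (hP : IsPearson L σ τ)
    (hσ : σ.natDegree ≤ 2) (hτ : τ.natDegree ≤ 1) :
    skewOp σ τ (p 0) = C (skewCoeff σ τ 0) * p 1 := by
  rw [← sub_eq_zero]
  set r := skewOp σ τ (p 0) - C (skewCoeff σ τ 0) * p 1 with hr
  have h1 : r.natDegree ≤ 0 + 1 :=
    natDegree_sub_le_of_le_of_le (natDegree_skewOp_le hσ hτ (H.natDegree_le _))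
      ((natDegree_C_mul_le _ _).trans (H.natDegree_le _))
  have h2 : r.coeff (0 + 1) = 0 := by
    rw [hr, coeff_sub, coeff_skewOp hσ hτ (H.natDegree_le _), coeff_C_mul, H.coeff_self,
      H.coeff_self]
    ring
  have h3 := natDegree_le_of_succ h1 h2
  refine H.eq_zero_of_apply fun d hd => ?_
  obtain rfl : d = 0 := by omega
  have e : p 0 * r = p 0 * skewOp σ τ (p 0) - skewCoeff σ τ 0 • (p 0 * p 1) := by
    rw [hr, smul_eq_C_mul]; ring
  have := hP.skew (p 0) (p 0)
  rw [mul_comm] at this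
  rw [e, map_sub, map_smul, H.apply_mul_of_ne (by omega : 0 ≠ 1), smul_zero, sub_zero]
  linarith

/-- The Christoffel–Darboux type telescoping of `∑ (σ w pᵢ²)' / hᵢ`, tested against an arbitrary
functional. -/
theorem sum_skewOp (H : IsMonicOrthogonal L p h) {σ τ : ℝ[X]} (hP : IsPearson L σ τ)
    (hσ : σ.natDegree ≤ 2) (hτ : τ.natDegree ≤ 1) (L' : ℝ[X] →ₗ[ℝ] ℝ) (n : ℕ) :
    ∑ i ∈ Finset.range (n + 1), L' (skewOp σ τ (p i) * p i) / h i
      = skewCoeff σ τ n / h n * L' (p (n + 1) * p n) := by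
  induction n with
  | zero =>
    rw [Finset.sum_range_one, H.skewOp_zero hP hσ hτ, mul_assoc, ← smul_eq_C_mul, map_smul,
      smul_eq_mul]
    ring
  | succ n ih =>
    have e : skewOp σ τ (p (n + 1)) * p (n + 1)
        = skewCoeff σ τ (n + 1) • (p (n + 1 + 1) * p (n + 1))
          - (skewCoeff σ τ n * h (n + 1) / h n) • (p (n + 1) * p n) := by
      rw [H.skewOp_succ hP hσ hτ, smul_eq_C_mul, smul_eq_C_mul]; ring
    rw [Finset.sum_range_succ, ih, e, map_sub, map_smul, map_smul, smul_eq_mul, smul_eq_mul]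
    have h1 := (H.norm_pos n).ne'
    have h2 := (H.norm_pos (n + 1)).ne'
    field_simp
    ring

/-- This is the trace of the truncated Jacobi matrix. Its `i`-th diagonal entry is the difference of
the subleading coefficients of `p i` and `p (i + 1)`, so the trace telescopes. -/
theorem sum_apply_X (H : IsMonicOrthogonal L p h) (n : ℕ) :
    ∑ i ∈ Finset.range (n + 1), L (X * (p i * p i)) / h i = -(p (n + 1)).coeff n := by
  have key : ∀ i, L (p i * (X * p i - p (i + 1))) / h i
      = (X * p i - p (i + 1)).coeff i := by
    intro i
    rw [H.apply_mul, mul_div_cancel_right₀ _ (H.norm_pos i).ne']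
    apply natDegree_le_of_succ
    · refine natDegree_sub_le_of_le_of_le ?_ (H.natDegree_le _)
      have := natDegree_mul_le (p := (X : ℝ[X])) (q := p i)
      have := H.natDegree_le i
      have := natDegree_X_le (R := ℝ)
      omega
    · rw [coeff_sub, coeff_X_mul, H.coeff_self, H.coeff_self, sub_self]
  have key2 : ∀ i, L (X * (p i * p i)) / h i = (X * p i).coeff i - (p (i + 1)).coeff i := by
    intro i
    rw [← coeff_sub, ← key, mul_sub, map_sub, H.apply_mul_of_ne (by omega : i ≠ i + 1), sub_zero]
    congr 2; ring
  induction n with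
  | zero => rw [Finset.sum_range_one, key2]; simp
  | succ n ih => rw [Finset.sum_range_succ, ih, key2, coeff_X_mul]; ring

end IsMonicOrthogonal

/-! ### Rodrigues' formula for quadratic `σ` and linear `τ` -/

/-- `p` is the monic orthogonal polynomial of degree `n` of `L`, with squared norm `h`. -/
structure IsMonicOrthogonalAt (L : ℝ[X] →ₗ[ℝ] ℝ) (n : ℕ) (p : ℝ[X]) (h : ℝ) : Prop where
  natDegree_le : p.natDegree ≤ n
  coeff_self : p.coeff n = 1
  apply_mul : ∀ q, q.natDegree ≤ n → L (p * q) = q.coeff n * h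
  norm_pos : 0 < h

theorem isMonicOrthogonal_of_forall {L : ℝ[X] →ₗ[ℝ] ℝ} {p : ℕ → ℝ[X]} {h : ℕ → ℝ}
    (H : ∀ n, IsMonicOrthogonalAt L n (p n) (h n)) : IsMonicOrthogonal L p h :=
  ⟨fun n => (H n).1, fun n => (H n).2, fun n => (H n).3, fun n => (H n).4⟩

/-- The coefficient `σ = x (1 - s x)` of the Pearson equation. -/
noncomputable def pearsonSigma (s : ℝ) : ℝ[X] := X * (1 - C s * X)

/-- The coefficient `τ = β - γ x` of the Pearson equation. -/
noncomputable def pearsonTau (β γ : ℝ) : ℝ[X] := C β - C γ * X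

/-- The operator `q ↦ (σ w q)' / w`, raising the degree by one. -/
noncomputable def raiseOp (β γ s : ℝ) (q : ℝ[X]) : ℝ[X] :=
  pearsonTau β γ * q + pearsonSigma s * derivative q

theorem natDegree_pearsonSigma_le (s : ℝ) : (pearsonSigma s).natDegree ≤ 2 := by
  unfold pearsonSigma; compute_degree

theorem natDegree_pearsonTau_le (β γ : ℝ) : (pearsonTau β γ).natDegree ≤ 1 := by
  unfold pearsonTau; compute_degree

theorem skewCoeff_pearson (β γ s : ℝ) (n : ℕ) :
    skewCoeff (pearsonSigma s) (pearsonTau β γ) n = -(γ + 2 * n * s) := by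
  have h1 : (pearsonTau β γ).coeff 1 = -γ := by simp [pearsonTau, coeff_C]
  have h2 : (pearsonSigma s).coeff 2 = -s := by
    simp [pearsonSigma, coeff_X_mul, coeff_one]
  rw [skewCoeff, h1, h2]; ring

theorem coeff_raiseOp (β γ s : ℝ) (q : ℝ[X]) (k : ℕ) :
    (raiseOp β γ s q).coeff (k + 1)
      = (β + k + 1) * q.coeff (k + 1) - (γ + s * k) * q.coeff k := by
  have e : raiseOp β γ s q = C β * q - C γ * (X * q) + X * derivative q
      - C s * (X * (X * derivative q)) := by
    simp only [raiseOp, pearsonTau, pearsonSigma]; ring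
  have e2 : (X * derivative q).coeff k = k * q.coeff k := by
    cases k with
    | zero => simp
    | succ k => rw [coeff_X_mul, coeff_derivative]; push_cast; ring
  rw [e]
  simp only [coeff_sub, coeff_add, coeff_C_mul, coeff_X_mul, coeff_derivative, e2]
  ring

theorem natDegree_raiseOp_le (β γ s : ℝ) {q : ℝ[X]} {n : ℕ} (hq : q.natDegree ≤ n) :
    (raiseOp β γ s q).natDegree ≤ n + 1 := by
  rw [natDegree_le_iff_coeff_eq_zero]
  intro m hm
  obtain ⟨k, rfl⟩ : ∃ k, m = k + 1 := ⟨m - 1, by omega⟩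
  rw [coeff_raiseOp, coeff_eq_zero_of_natDegree_lt (by omega),
    coeff_eq_zero_of_natDegree_lt (by omega)]
  ring

/-- On `X ^ k` the Pearson equation is exactly the first-order recursion `hμ`; linearity does the
rest. -/
theorem isPearson_of_moments {μ : ℕ → ℝ} {β γ s : ℝ}
    (hμ : ∀ k : ℕ, (β + k) * μ k = (γ + s * k) * μ (k + 1)) :
    IsPearson (momentFunctional μ) (pearsonSigma s) (pearsonTau β γ) := by
  intro q
  change momentFunctional μ (raiseOp β γ s q) = 0
  induction q using Polynomial.induction_on' with
  | add p q hp hq =>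
    have : raiseOp β γ s (p + q) = raiseOp β γ s p + raiseOp β γ s q := by
      simp only [raiseOp, derivative_add]; ring
    rw [this, map_add, hp, hq, add_zero]
  | monomial k c =>
    have e : raiseOp β γ s (monomial k c)
        = monomial k ((β + k) * c) - monomial (k + 1) ((γ + s * k) * c) := by
      ext m
      cases m with
      | zero =>
        rcases Nat.eq_zero_or_pos k with rfl | hk
        · simp [raiseOp, pearsonSigma, pearsonTau, coeff_monomial]
        · simp [raiseOp, pearsonSigma, pearsonTau, coeff_monomial, hk.ne']
      | succ m =>
        rw [coeff_raiseOp]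
        simp only [coeff_sub, coeff_monomial, Nat.add_right_cancel_iff]
        by_cases h1 : k = m + 1
        · subst h1
          simp only [if_true, Nat.succ_ne_self, if_false]
          push_cast
          ring
        · by_cases h2 : k = m
          · subst h2; simp
          · simp [h1, h2]
    rw [e, map_sub, momentFunctional_monomial, momentFunctional_monomial]
    linear_combination c * hμ k

/-- One step of the Rodrigues formula. -/
theorem IsMonicOrthogonalAt.raise {L L' : ℝ[X] →ₗ[ℝ] ℝ} {β γ s : ℝ} {n : ℕ} {p : ℝ[X]} {h : ℝ}
    (H : IsMonicOrthogonalAt L' n p h) (hP : IsPearson L (pearsonSigma s) (pearsonTau β γ))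
    (hL : ∀ q, L' q = L (pearsonSigma s * q)) (hγ : 0 < γ + s * n) :
    IsMonicOrthogonalAt L (n + 1) (C (-(γ + s * n)⁻¹) * raiseOp β γ s p)
      ((n + 1) / (γ + s * n) * h) where
  natDegree_le := (natDegree_C_mul_le _ _).trans (natDegree_raiseOp_le _ _ _ H.natDegree_le)
  coeff_self := by
    rw [coeff_C_mul, coeff_raiseOp, H.coeff_self,
      coeff_eq_zero_of_natDegree_lt (Nat.lt_succ_of_le H.natDegree_le)]
    field_simp
    ring
  apply_mul q hq := by
    -- Integration by parts: pairing the raised polynomial with `q` amounts to pairing `p` with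
    -- `-q'` under the weight `σ w`, where `q'` has degree one less.
    have h1 := hP (p * q)
    have e : C (-(γ + s * n)⁻¹) * raiseOp β γ s p * q
        = (-(γ + s * n)⁻¹) • ((pearsonTau β γ * (p * q) + pearsonSigma s * derivative (p * q))
          - pearsonSigma s * (p * derivative q)) := by
      rw [smul_eq_C_mul, raiseOp, derivative_mul]; ring
    have h2 := natDegree_derivative_le q
    rw [e, map_smul, map_sub, h1, ← hL, H.apply_mul _ (by omega), coeff_derivative, smul_eq_mul]
    field_simp
    ring
  norm_pos := by have := H.norm_pos; positivity

theorem isMonicOrthogonalAt_zero {L : ℝ[X] →ₗ[ℝ] ℝ} (h : 0 < L 1) :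
    IsMonicOrthogonalAt L 0 1 (L 1) where
  natDegree_le := by simp
  coeff_self := by simp
  apply_mul q hq := by
    obtain ⟨c, rfl⟩ := natDegree_eq_zero.1 (Nat.le_zero.1 hq)
    rw [one_mul, ← mul_one (C c), ← smul_eq_C_mul, map_smul]
    simp
  norm_pos := h

/-! ### Jacobi polynomials -/

/-- The moments of the Jacobi weight `x^b (1-x)^a` on `[0, 1]`. -/
noncomputable def jacobiMu (a b : ℝ) (k : ℕ) : ℝ :=
  Real.Gamma (a + 1) * Real.Gamma (b + k + 1) / Real.Gamma (a + b + k + 2)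

/-- The moment functional of the Jacobi weight. -/
noncomputable def jacobiL (a b : ℝ) : ℝ[X] →ₗ[ℝ] ℝ := momentFunctional (jacobiMu a b)

/-- The monic Jacobi polynomials for the weight `x^b (1-x)^a` on `[0, 1]`. -/
noncomputable def jacobiP : ℕ → ℝ → ℝ → ℝ[X]
  | 0, _, _ => 1
  | n + 1, a, b => C (-(a + b + 2 + 1 * n)⁻¹) *
      raiseOp (b + 1) (a + b + 2) 1 (jacobiP n (a + 1) (b + 1))

/-- The squared norms of the monic Jacobi polynomials. -/
noncomputable def jacobiH (n : ℕ) (a b : ℝ) : ℝ :=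
  n.factorial * (Real.Gamma (a + b + n + 1) / Real.Gamma (a + b + 2 * n + 1)) *
    (Real.Gamma (a + n + 1) * Real.Gamma (b + n + 1) / Real.Gamma (a + b + 2 * n + 2))

theorem gamma_add_one {x : ℝ} (hx : 0 < x) {y : ℝ} (hy : y = x + 1) :
    Real.Gamma y = x * Real.Gamma x := by
  rw [hy, Real.Gamma_add_one hx.ne']

theorem isPearson_jacobiL {a b : ℝ} (ha : -1 < a) (hb : -1 < b) :
    IsPearson (jacobiL a b) (pearsonSigma 1) (pearsonTau (b + 1) (a + b + 2)) := by
  refine isPearson_of_moments fun k => ?_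
  have hk : (0 : ℝ) ≤ k := k.cast_nonneg
  have h1 : 0 < b + k + 1 := by linarith
  have h2 : 0 < a + b + k + 2 := by linarith
  have h3 := (Real.Gamma_pos_of_pos h2).ne'
  rw [jacobiMu, jacobiMu, gamma_add_one h1 (by push_cast; ring : b + (k + 1 : ℕ) + 1 = _),
    gamma_add_one h2 (by push_cast; ring : a + b + (k + 1 : ℕ) + 2 = _)]
  field_simp
  ring

theorem jacobiL_add_one_right {a b : ℝ} (q : ℝ[X]) : jacobiL a (b + 1) q = jacobiL a b (X * q) := by
  have : jacobiL a (b + 1) = (jacobiL a b).comp (LinearMap.mulLeft ℝ X) := by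
    refine linearMap_eq_of_monomial fun k => ?_
    simp only [LinearMap.comp_apply, LinearMap.mulLeft_apply, X_mul_monomial, jacobiL,
      momentFunctional_monomial, jacobiMu, one_mul]
    push_cast
    ring_nf
  rw [this]; rfl

/-- Multiplication by `σ = x (1 - x)` raises both parameters, which is what
`IsMonicOrthogonalAt.raise` needs to climb from `(a + 1, b + 1)` to `(a, b)`. -/
theorem jacobiL_add_one_add_one {a b : ℝ} (ha : -1 < a) (hb : -1 < b) (q : ℝ[X]) :
    jacobiL (a + 1) (b + 1) q = jacobiL a b (pearsonSigma 1 * q) := by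
  have : jacobiL (a + 1) (b + 1) = (jacobiL a b).comp (LinearMap.mulLeft ℝ (pearsonSigma 1)) := by
    refine linearMap_eq_of_monomial fun k => ?_
    have e : pearsonSigma 1 * monomial k (1 : ℝ) = monomial (k + 1) 1 - monomial (k + 2) 1 := by
      rw [pearsonSigma, C_1, one_mul, mul_sub, mul_one, sub_mul, X_mul_monomial, mul_assoc,
        X_mul_monomial, X_mul_monomial]
    have hk : (0 : ℝ) ≤ k := k.cast_nonneg
    have h1 : 0 < b + k + 2 := by linarith
    have h2 : 0 < a + b + k + 3 := by linarith
    have h3 := (Real.Gamma_pos_of_pos h2).ne'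
    have h4 : 0 < a + 1 := by linarith
    simp only [LinearMap.comp_apply, LinearMap.mulLeft_apply, e, jacobiL, map_sub,
      momentFunctional_monomial, jacobiMu, one_mul]
    rw [gamma_add_one h4 rfl, gamma_add_one h1 (by push_cast; ring : b + (k + 2 : ℕ) + 1 = _),
      gamma_add_one h2 (by push_cast; ring : a + b + (k + 2 : ℕ) + 2 = _),
      gamma_add_one h2 (by ring : a + 1 + (b + 1) + k + 2 = _),
      show b + 1 + k + 1 = b + k + 2 by ring,
      show b + (k + 1 : ℕ) + 1 = b + k + 2 by push_cast; ring,
      show a + b + (k + 1 : ℕ) + 2 = a + b + k + 3 by push_cast; ring]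
    field_simp
    ring
  rw [this]; rfl

theorem jacobiH_succ {a b : ℝ} (ha : -1 < a) (hb : 0 ≤ b) (n : ℕ) :
    jacobiH (n + 1) a b = (n + 1) / (a + b + 2 + 1 * n) * jacobiH n (a + 1) (b + 1) := by
  have hn : (0 : ℝ) ≤ n := n.cast_nonneg
  have h1 : 0 < a + b + n + 2 := by linarith
  rw [jacobiH, jacobiH, Nat.factorial_succ,
    gamma_add_one h1 (by ring : a + 1 + (b + 1) + n + 1 = _)]
  push_cast
  rw [show a + b + ((n : ℝ) + 1) + 1 = a + b + n + 2 by ring,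
    show a + b + 2 * ((n : ℝ) + 1) + 1 = a + 1 + (b + 1) + 2 * n + 1 by ring,
    show a + b + 2 * ((n : ℝ) + 1) + 2 = a + 1 + (b + 1) + 2 * n + 2 by ring,
    show a + ((n : ℝ) + 1) + 1 = a + 1 + n + 1 by ring,
    show b + ((n : ℝ) + 1) + 1 = b + 1 + n + 1 by ring,
    show a + b + 2 + 1 * (n : ℝ) = a + b + n + 2 by ring]
  field_simp

theorem isMonicOrthogonalAt_jacobiP (n : ℕ) {a b : ℝ} (ha : -1 < a) (hb : 0 ≤ b) :
    IsMonicOrthogonalAt (jacobiL a b) n (jacobiP n a b) (jacobiH n a b) := by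
  induction n generalizing a b with
  | zero =>
    have e : jacobiL a b 1 = jacobiH 0 a b := by
      rw [← monomial_zero_one, jacobiL, momentFunctional_monomial, jacobiMu, jacobiH]
      -- In degree zero `jacobiH` contains `Γ(a+b+1) / Γ(a+b+1)`, which is `1` only where this Gamma
      -- value is nonzero.
      have : 0 < a + b + 1 := by linarith
      have := (Real.Gamma_pos_of_pos this).ne'
      simp [this]
    rw [← e]
    refine isMonicOrthogonalAt_zero ?_
    rw [e, jacobiH]
    have h1 : 0 < a + b + 1 := by linarith
    have h2 : 0 < a + b + 2 := by linarith
    have h3 : 0 < a + 1 := by linarith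
    have h4 : 0 < b + 1 := by linarith
    have := Real.Gamma_pos_of_pos h1
    have := Real.Gamma_pos_of_pos h2
    have := Real.Gamma_pos_of_pos h3
    have := Real.Gamma_pos_of_pos h4
    simp only [Nat.cast_zero, mul_zero, add_zero, Nat.factorial_zero, Nat.cast_one]
    positivity
  | succ n ih =>
    rw [jacobiH_succ ha hb]
    exact (ih (by linarith : -1 < a + 1) (by linarith : 0 ≤ b + 1)).raise
      (isPearson_jacobiL ha (by linarith)) (jacobiL_add_one_add_one ha (by linarith))
      (by have : (0 : ℝ) ≤ n := n.cast_nonneg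
          linarith)

theorem isMonicOrthogonal_jacobiP {a b : ℝ} (ha : -1 < a) (hb : 0 ≤ b) :
    IsMonicOrthogonal (jacobiL a b) (fun n => jacobiP n a b) (fun n => jacobiH n a b) :=
  isMonicOrthogonal_of_forall fun n => isMonicOrthogonalAt_jacobiP n ha hb

theorem coeff_jacobiP_pred (n : ℕ) {a b : ℝ} (ha : -1 < a) (hb : 0 ≤ b) :
    (jacobiP (n + 1) a b).coeff n = -((n + 1) * (b + n + 1)) / (a + b + 2 * n + 2) := by
  induction n generalizing a b with
  | zero =>
    have : a + b + 2 ≠ 0 := by linarith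
    simp only [jacobiP, raiseOp, pearsonTau, pearsonSigma]
    simp [mul_coeff_zero]
    field_simp
    ring
  | succ n ih =>
    have hn : (0 : ℝ) ≤ n := n.cast_nonneg
    have h1 : 0 < a + b + 2 + (n + 1) := by linarith
    have h2 : 0 < a + b + 2 * n + 4 := by linarith
    rw [jacobiP, coeff_C_mul, coeff_raiseOp, ih (by linarith) (by linarith),
      (isMonicOrthogonalAt_jacobiP (n + 1) (by linarith : -1 < a + 1)
        (by linarith : 0 ≤ b + 1)).coeff_self]
    push_cast
    rw [show a + 1 + (b + 1) + 2 * (n : ℝ) + 2 = a + b + 2 * n + 4 by ring,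
      show a + b + 2 * ((n : ℝ) + 1) + 2 = a + b + 2 * n + 4 by ring, one_mul]
    field_simp
    ring

/-! ### Moments of the Jacobi one-point density -/

/-- `S(k) = ∑_{i<n} ∫ x^k pᵢ² w / hᵢ`, the moments of the Jacobi one-point density. -/
noncomputable def jacobiS (a b : ℝ) (n k : ℕ) : ℝ :=
  ∑ i ∈ Finset.range n, jacobiL a b (X ^ k * (jacobiP i a b * jacobiP i a b)) / jacobiH i a b

theorem jacobiS_one (n : ℕ) {a b : ℝ} (ha : -1 < a) (hb : 0 ≤ b) :
    jacobiS a b (n + 1) 1 = (n + 1) * (b + n + 1) / (a + b + 2 * n + 2) := by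
  simp only [jacobiS, pow_one]
  rw [(isMonicOrthogonal_jacobiP ha hb).sum_apply_X, coeff_jacobiP_pred n ha hb]
  ring

/-- Integrating `x^k (σ w p_i^2)'` by parts gives `-k ∫ x^k (1 - x) p_i^2 w`, a difference of
consecutive moments; the telescoped sum supplies the right side. -/
theorem jacobiS_succ (n k : ℕ) {a b : ℝ} (ha : -1 < a) (hb : 0 ≤ b) :
    k * (jacobiS a b (n + 1) k - jacobiS a b (n + 1) (k + 1))
      = (a + b + 2 * n + 2) / jacobiH n a b *
        jacobiL a b (X ^ k * (jacobiP (n + 1) a b * jacobiP n a b)) := by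
  have hP := isPearson_jacobiL ha (by linarith : -1 < b)
  have key := (isMonicOrthogonal_jacobiP ha hb).sum_skewOp hP
    (natDegree_pearsonSigma_le _) (natDegree_pearsonTau_le _ _)
    ((jacobiL a b).comp (LinearMap.mulLeft ℝ (X ^ k))) n
  rw [skewCoeff_pearson] at key
  simp only [LinearMap.comp_apply, LinearMap.mulLeft_apply] at key
  have e : ∀ i, jacobiL a b (X ^ k * (skewOp (pearsonSigma 1) (pearsonTau (b + 1) (a + b + 2))
        (jacobiP i a b) * jacobiP i a b)) / jacobiH i a b
      = k * (jacobiL a b (X ^ (k + 1) * (jacobiP i a b * jacobiP i a b)) / jacobiH i a b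
        - jacobiL a b (X ^ k * (jacobiP i a b * jacobiP i a b)) / jacobiH i a b) := by
    intro i
    set P := jacobiP i a b
    have h1 := hP (X ^ k * (P * P))
    have e1 : X ^ k * (skewOp (pearsonSigma 1) (pearsonTau (b + 1) (a + b + 2)) P * P)
        = (pearsonTau (b + 1) (a + b + 2) * (X ^ k * (P * P))
            + pearsonSigma 1 * derivative (X ^ k * (P * P)))
          + (k : ℝ) • (X ^ (k + 1) * (P * P) - X ^ k * (P * P)) := by
      -- The derivative of `X ^ k` enters only together with the factor `X` of `σ`, so no exponent
      -- `k - 1` is needed.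
      have hX : X * derivative (X ^ k : ℝ[X]) = C (k : ℝ) * X ^ k := by
        cases k with
        | zero => simp
        | succ k => rw [derivative_X_pow]; simp; ring
      have hX2 : derivative (X ^ k * (P * P)) * X
          = C (k : ℝ) * X ^ k * (P * P) + 2 * X * X ^ k * derivative P * P := by
        rw [derivative_mul, derivative_mul, ← hX]; ring
      rw [pearsonSigma, skewOp, smul_eq_C_mul, C_1]
      linear_combination (-(1 - X)) * hX2
    rw [e1, map_add, h1, map_smul, map_sub, zero_add, smul_eq_mul]
    ring
  rw [Finset.sum_congr rfl fun i _ => e i, ← Finset.mul_sum, Finset.sum_sub_distrib] at key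
  simp only [jacobiS]
  linear_combination -key

/-- The first expansion starts one degree higher: its leading term has no partner, and its
coefficient `i + 1` meets coefficient `i` of the second. -/
theorem IsMonicOrthogonal.apply_expansion {L : ℝ[X] →ₗ[ℝ] ℝ} {p : ℕ → ℝ[X]} {h : ℕ → ℝ}
    (H : IsMonicOrthogonal L p h) (n : ℕ) (α β : ℕ → ℝ) :
    L ((∑ i ∈ Finset.range (n + 2), C (α i) * p (n + 1 - i))
        * ∑ i ∈ Finset.range (n + 1), C (β i) * p (n - i))
      = ∑ i ∈ Finset.range (n + 1), α (i + 1) * β i * h (n - i) := by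
  rw [Finset.sum_mul_sum, map_sum, Finset.sum_range_succ']
  have e : ∀ i j, L (C (α i) * p (n + 1 - i) * (C (β j) * p (n - j)))
      = α i * β j * L (p (n + 1 - i) * p (n - j)) := by
    intro i j
    rw [← smul_eq_mul (α i * β j), ← map_smul, smul_eq_C_mul, C_mul]
    congr 1; ring
  have h0 : L (∑ j ∈ Finset.range (n + 1), C (α 0) * p (n + 1 - 0) * (C (β j) * p (n - j))) = 0 := by
    rw [map_sum]
    refine Finset.sum_eq_zero fun j _ => ?_
    rw [e, H.apply_mul_of_ne (by omega), mul_zero]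
  rw [h0, add_zero]
  refine Finset.sum_congr rfl fun i hi => ?_
  rw [map_sum, Finset.sum_eq_single i]
  · rw [e, show n + 1 - (i + 1) = n - i by omega, H.apply_self]
  · intro j hj hij
    rw [Finset.mem_range] at hi hj
    rw [e, H.apply_mul_of_ne (by omega), mul_zero]
  · exact fun h => absurd hi h

/-! ### Connection coefficients of the Jacobi polynomials -/

/-- The coefficient of the Jacobi polynomial of degree `n - i` for the weight `x^(b+k) (1-x)^a` in
the one of degree `n` for the weight `x^b (1-x)^a`. -/
noncomputable def jacobiC (a b : ℝ) (k n i : ℕ) : ℝ :=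
  k.choose i * n.descFactorial i * (Real.Gamma (a + n + 1) / Real.Gamma (a + n - i + 1)) *
    (Real.Gamma (a + b + 2 * n - i + 1) / Real.Gamma (a + b + 2 * n + 1)) *
    (Real.Gamma (a + b + 2 * n + k - 2 * i + 2) / Real.Gamma (a + b + 2 * n + k - i + 2))

theorem jacobiP_connection (n : ℕ) {a b : ℝ} (ha : -1 < a) (hb : 0 ≤ b) :
    jacobiP (n + 1) a b = jacobiP (n + 1) a (b + 1)
      + C ((n + 1) * (a + n + 1) / ((a + b + 2 * n + 2) * (a + b + 2 * n + 3)))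
        * jacobiP n a (b + 1) := by
  have hn : (0 : ℝ) ≤ n := n.cast_nonneg
  rw [(isMonicOrthogonal_jacobiP ha hb).connection
    (isMonicOrthogonal_jacobiP ha (by linarith : 0 ≤ b + 1)) jacobiL_add_one_right n]
  congr 3
  have h1 : 0 < a + n + 1 := by linarith
  have h2 : 0 < a + b + 2 * n + 2 := by linarith
  have h3 : 0 < a + b + 2 * n + 3 := by linarith
  have h4 : 0 < a + b + n + 2 := by linarith
  have h5 : 0 < b + n + 2 := by linarith
  have g1 := (Real.Gamma_pos_of_pos h1).ne'
  have g2 := (Real.Gamma_pos_of_pos h2).ne'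
  have g4 := (Real.Gamma_pos_of_pos h4).ne'
  have g5 := (Real.Gamma_pos_of_pos h5).ne'
  rw [jacobiH, jacobiH, Nat.factorial_succ]
  push_cast
  rw [show a + b + ((n : ℝ) + 1) + 1 = a + b + n + 2 by ring,
    show a + (b + 1) + (n : ℝ) + 1 = a + b + n + 2 by ring,
    show a + b + 2 * ((n : ℝ) + 1) + 1 = a + b + 2 * n + 3 by ring,
    show a + (b + 1) + 2 * (n : ℝ) + 1 = a + b + 2 * n + 2 by ring,
    show a + (b + 1) + 2 * (n : ℝ) + 2 = a + b + 2 * n + 3 by ring,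
    show b + ((n : ℝ) + 1) + 1 = b + n + 2 by ring,
    show b + 1 + (n : ℝ) + 1 = b + n + 2 by ring,
    gamma_add_one h1 (by ring : a + ((n : ℝ) + 1) + 1 = _),
    gamma_add_one h3 (by ring : a + b + 2 * ((n : ℝ) + 1) + 2 = _),
    gamma_add_one h2 (by ring : a + b + 2 * (n : ℝ) + 3 = _)]
  have f6 : (n.factorial : ℝ) ≠ 0 := by positivity
  have x2 := h2.ne'
  have x3 := h3.ne'
  generalize Real.Gamma (a + b + 2 * n + 2) = G2 at *
  generalize a + b + 2 * (n : ℝ) + 2 = y2 at *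
  generalize a + b + 2 * (n : ℝ) + 3 = y3 at *
  field_simp

/-- This is the recursion forced by applying `jacobiP_connection` once more. After the Gamma factors
cancel it reduces to `(i+1) * choose k (i+1) = (k-i) * choose k i`. -/
theorem jacobiC_succ_succ {a b : ℝ} (ha : -1 < a) (hb : 0 ≤ b) (k : ℕ) {n i : ℕ} (hi : i < n) :
    jacobiC a b (k + 1) n (i + 1) = jacobiC a b k n (i + 1) + jacobiC a b k n i *
      ((n - i) * (a + n - i) / ((a + b + 2 * n + k - 2 * i) * (a + b + 2 * n + k - 2 * i + 1))) := by
  rcases lt_or_ge k i with hk | hk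
  · simp [jacobiC, Nat.choose_eq_zero_of_lt hk, Nat.choose_eq_zero_of_lt (by omega : k < i + 1),
      Nat.choose_eq_zero_of_lt (by omega : k + 1 < i + 1)]
  have hi' : (i : ℝ) + 1 ≤ n := by exact_mod_cast hi
  have hk' : (i : ℝ) ≤ k := by exact_mod_cast hk
  have hi0 : (0 : ℝ) ≤ i := i.cast_nonneg
  have h1 : 0 < a + n - i := by linarith
  have h2 : 0 < a + b + 2 * n - i := by linarith
  have h3 : 0 < a + b + 2 * n + k - 2 * i := by linarith
  have h4 : 0 < a + b + 2 * n + k - 2 * i + 1 := by linarith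
  have h5 : 0 < a + b + 2 * n + k - i + 1 := by linarith
  have h6 : 0 < a + b + 2 * n + 1 := by linarith
  have g1 := (Real.Gamma_pos_of_pos h1).ne'
  have g3 := (Real.Gamma_pos_of_pos h3).ne'
  have g5 := (Real.Gamma_pos_of_pos h5).ne'
  have g6 := (Real.Gamma_pos_of_pos h6).ne'
  have hc : (k.choose (i + 1) : ℝ) * (i + 1) = k.choose i * (k - i) := by
    rw [← Nat.cast_sub hk]; exact_mod_cast Nat.choose_succ_right_eq k i
  rw [jacobiC, jacobiC, jacobiC, Nat.choose_succ_succ, Nat.descFactorial_succ]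
  push_cast [Nat.cast_sub hi.le]
  rw [show a + (n : ℝ) - (i + 1) + 1 = a + n - i by ring,
    show a + b + 2 * (n : ℝ) - (i + 1) + 1 = a + b + 2 * n - i by ring,
    show a + b + 2 * (n : ℝ) + k - 2 * (i + 1) + 2 = a + b + 2 * n + k - 2 * i by ring,
    show a + b + 2 * (n : ℝ) + k - (i + 1) + 2 = a + b + 2 * n + k - i + 1 by ring,
    gamma_add_one h1 rfl, gamma_add_one h2 rfl,
    gamma_add_one h3 (by ring : a + b + 2 * (n : ℝ) + (k + 1) - 2 * (i + 1) + 2 = _),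
    gamma_add_one h4 (by ring : a + b + 2 * (n : ℝ) + k - 2 * i + 2 = _),
    gamma_add_one h3 rfl,
    gamma_add_one h5 (by ring : a + b + 2 * (n : ℝ) + (k + 1) - (i + 1) + 2 = _),
    gamma_add_one h5 (by ring : a + b + 2 * (n : ℝ) + k - i + 2 = _)]
  have hc' : (k.choose (i + 1) : ℝ) * (a + b + 2 * n + k - i + 1)
      + k.choose i * (a + b + 2 * n - i)
      = (k.choose i + k.choose (i + 1)) * (a + b + 2 * n + k - 2 * i) := by
    linear_combination hc
  have x1 := h1.ne'
  have x3 := h3.ne'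
  have x4 := h4.ne'
  have x5 := h5.ne'
  clear hc h1 h2 h3 h4 h5 h6
  generalize Real.Gamma (a + n - i) = G1 at *
  generalize Real.Gamma (a + b + 2 * n + k - 2 * i) = G3 at *
  generalize Real.Gamma (a + b + 2 * n + k - i + 1) = G5 at *
  generalize Real.Gamma (a + b + 2 * n + 1) = G6 at *
  generalize Real.Gamma (a + b + 2 * n - i) = G2 at *
  generalize Real.Gamma (a + n + 1) = G7 at *
  generalize a + (n : ℝ) - i = y1 at *
  generalize a + b + 2 * (n : ℝ) + k - 2 * i + 1 = y4 at *
  generalize a + b + 2 * (n : ℝ) + k - 2 * i = y3 at *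
  generalize a + b + 2 * (n : ℝ) + k - i + 1 = y5 at *
  generalize a + b + 2 * (n : ℝ) - i = y2 at *
  field_simp
  linear_combination -(((n : ℝ) - i) * n.descFactorial i * G7 * G2) * hc'

theorem jacobiC_zero_right {a b : ℝ} (ha : -1 < a) (hb : 0 ≤ b) (k n : ℕ) :
    jacobiC a b k n 0 = 1 := by
  have hn : (0 : ℝ) ≤ n := n.cast_nonneg
  have hk : (0 : ℝ) ≤ k := k.cast_nonneg
  have h1 : 0 < a + n + 1 := by linarith
  have h2 : 0 < a + b + 2 * n + 1 := by linarith
  have h3 : 0 < a + b + 2 * n + k + 2 := by linarith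
  have g1 := (Real.Gamma_pos_of_pos h1).ne'
  have g2 := (Real.Gamma_pos_of_pos h2).ne'
  have g3 := (Real.Gamma_pos_of_pos h3).ne'
  simp [jacobiC, g1, g2, g3]

theorem jacobiP_expansion {a b : ℝ} (ha : -1 < a) (hb : 0 ≤ b) (k n : ℕ) :
    jacobiP n a b = ∑ i ∈ Finset.range (n + 1), C (jacobiC a b k n i) * jacobiP (n - i) a (b + k) := by
  induction k with
  | zero =>
    rw [Finset.sum_range_succ', Finset.sum_eq_zero]
    · simp [jacobiC_zero_right ha hb]
    · intro i _
      simp [jacobiC]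
  | succ k ih =>
    have hbk : 0 ≤ b + k := add_nonneg hb k.cast_nonneg
    have step : ∀ i ∈ Finset.range n, C (jacobiC a b k n i) * jacobiP (n - i) a (b + k)
        = C (jacobiC a b k n i) * jacobiP (n - i) a (b + (k + 1 : ℕ))
          + C (jacobiC a b k n i * ((n - i) * (a + n - i) /
            ((a + b + 2 * n + k - 2 * i) * (a + b + 2 * n + k - 2 * i + 1))))
            * jacobiP (n - (i + 1)) a (b + (k + 1 : ℕ)) := by
      intro i hi
      rw [Finset.mem_range] at hi
      obtain ⟨m, rfl⟩ : ∃ m, n = i + 1 + m := ⟨n - (i + 1), by omega⟩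
      rw [show i + 1 + m - i = m + 1 by omega, show i + 1 + m - (i + 1) = m by omega,
        jacobiP_connection m ha hbk, C_mul]
      push_cast
      rw [← add_assoc b, mul_add, ← mul_assoc]
      congr 4
      congr 1
      · ring
      · ring
    rw [Finset.sum_range_succ']
    rw [ih, Finset.sum_range_succ, Finset.sum_congr rfl step, Finset.sum_add_distrib]
    -- The term of degree zero is constant and does not depend on the weight.
    have last : C (jacobiC a b k n n) * jacobiP (n - n) a (b + k)
        = C (jacobiC a b k n n) * jacobiP (n - n) a (b + (k + 1 : ℕ)) := by
      simp [jacobiP]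
    rw [last, add_right_comm, ← Finset.sum_range_succ
      (fun i => C (jacobiC a b k n i) * jacobiP (n - i) a (b + (k + 1 : ℕ))),
      Finset.sum_range_succ', add_right_comm, ← Finset.sum_add_distrib, jacobiC_zero_right ha hb,
      jacobiC_zero_right ha hb]
    congr 1
    refine Finset.sum_congr rfl fun i hi => ?_
    rw [jacobiC_succ_succ ha hb k (Finset.mem_range.1 hi), C_add]
    ring

theorem jacobiL_X_pow_mul {a b : ℝ} (k : ℕ) (q : ℝ[X]) :
    jacobiL a b (X ^ k * q) = jacobiL a (b + k) q := by
  induction k generalizing q with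
  | zero => simp
  | succ k ih =>
    rw [pow_succ, mul_assoc, ih, ← jacobiL_add_one_right]
    push_cast; ring_nf

theorem jacobiS_succ_eq (n k : ℕ) {a b : ℝ} (ha : -1 < a) (hb : 0 ≤ b) :
    k * (jacobiS a b (n + 1) k - jacobiS a b (n + 1) (k + 1))
      = ∑ i ∈ Finset.range (n + 1), (a + b + 2 * n + 2) / jacobiH n a b *
        (jacobiC a b k (n + 1) (i + 1) * jacobiC a b k n i * jacobiH (n - i) a (b + k)) := by
  rw [jacobiS_succ n k ha hb, jacobiL_X_pow_mul, jacobiP_expansion ha hb k (n + 1),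
    jacobiP_expansion ha hb k n,
    (isMonicOrthogonal_jacobiP ha (add_nonneg hb k.cast_nonneg)).apply_expansion n,
    Finset.mul_sum]

/-- Here the ensemble size is `n + 1` and the index of `coeffU` is `i + 1`. The condition `i < j`
keeps the Gamma arguments positive. -/
theorem coeffU_eq {a b : ℝ} (ha : -1 < a) (hb : 0 ≤ b) {m n j i : ℕ} {δ : ℝ} (hδ : δ / 2 = a)
    (hm : (m : ℝ) = b + n + 1) (hi : i ≤ n) (hij : i < j) :
    (a + b + 2 * n + 2) / jacobiH n a b *
        (jacobiC a b j (n + 1) (i + 1) * jacobiC a b j n i * jacobiH (n - i) a (b + j))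
      = j.choose (i + 1) * j.choose i * coeffU m (n + 1) δ (i + 1) j := by
  have hi' : (i : ℝ) ≤ n := by exact_mod_cast hi
  have hij' : (i : ℝ) + 1 ≤ j := by exact_mod_cast hij
  have hi0 : (0 : ℝ) ≤ i := i.cast_nonneg
  have h1 : 0 < a + b + n + 1 := by linarith
  have h2 : 0 < a + b + 2 * n + 1 := by linarith
  have h3 : 0 < a + n + 1 := by linarith
  have h4 : 0 < b + n + 1 := by linarith
  have h5 : 0 < a + b + 2 * n + 2 := by linarith
  have h6 : 0 < a + b + j + n - i + 1 := by linarith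
  have h7 : 0 < a + b + j + 2 * n - 2 * i + 1 := by linarith
  have h8 : 0 < a + n - i + 1 := by linarith
  have h9 : 0 < b + j + n - i + 1 := by linarith
  have h10 : 0 < a + b + j + 2 * n - 2 * i + 2 := by linarith
  have h11 : 0 < a + n + 2 := by linarith
  have h12 : 0 < a + b + 2 * n + 2 - i := by linarith
  have h13 : 0 < a + b + 2 * n + j - i + 3 := by linarith
  have h14 : 0 < a + b + 2 * n + 1 - i := by linarith
  have h15 : 0 < a + b + 2 * n + j - i + 2 := by linarith
  have g1 := (Real.Gamma_pos_of_pos h1).ne'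
  have g2 := (Real.Gamma_pos_of_pos h2).ne'
  have g3 := (Real.Gamma_pos_of_pos h3).ne'
  have g4 := (Real.Gamma_pos_of_pos h4).ne'
  have g5 := (Real.Gamma_pos_of_pos h5).ne'
  have g7 := (Real.Gamma_pos_of_pos h7).ne'
  have g8 := (Real.Gamma_pos_of_pos h8).ne'
  have g10 := (Real.Gamma_pos_of_pos h10).ne'
  have g11 := (Real.Gamma_pos_of_pos h11).ne'
  have g12 := (Real.Gamma_pos_of_pos h12).ne'
  have g13 := (Real.Gamma_pos_of_pos h13).ne'
  have g14 := (Real.Gamma_pos_of_pos h14).ne'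
  have g15 := (Real.Gamma_pos_of_pos h15).ne'
  have f1 : ((n - i).factorial : ℝ) ≠ 0 := by positivity
  have f2 : ((n - i).factorial : ℝ) * n.descFactorial i = n.factorial := by
    exact_mod_cast Nat.factorial_mul_descFactorial hi
  have f3 : ((n + 1 : ℕ).descFactorial (i + 1) : ℝ) = (n + 1) * n.descFactorial i := by
    rw [Nat.succ_descFactorial_succ]; push_cast; ring
  have f4 : Real.Gamma ((n : ℝ) + 1 - i) = (n - i).factorial := by
    rw [← Real.Gamma_nat_eq_factorial, Nat.cast_sub hi]; congr 1; ring
  have f5 : Real.Gamma ((n : ℝ) + 2) = (n + 1) * n.factorial := by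
    rw [show (n : ℝ) + 2 = (n + 1 : ℕ) + 1 by push_cast; ring, Real.Gamma_nat_eq_factorial,
      Nat.factorial_succ]; push_cast; ring
  have f6 : (n.factorial : ℝ) ≠ 0 := by positivity
  have f7 : (n : ℝ) + 1 ≠ 0 := by positivity
  have f8 : (n.descFactorial i : ℝ) = n.factorial / (n - i).factorial := by
    rw [← f2]; field_simp
  simp only [coeffU, poch, jacobiH, jacobiC, hδ, hm, f3]
  push_cast [Nat.cast_sub hi]
  rw [show a + (b + (j : ℝ)) + (n - i) + 1 = a + b + j + n - i + 1 by ring,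
    show a + (b + (j : ℝ)) + 2 * (n - i) + 1 = a + b + j + 2 * n - 2 * i + 1 by ring,
    show a + (b + (j : ℝ)) + 2 * (n - i) + 2 = a + b + j + 2 * n - 2 * i + 2 by ring,
    show a + ((n : ℝ) - i) + 1 = a + n - i + 1 by ring,
    show b + (j : ℝ) + (n - i) + 1 = b + j + n - i + 1 by ring,
    show a + ((n : ℝ) + 1) + 1 = a + n + 2 by ring,
    show a + ((n : ℝ) + 1) - (i + 1) + 1 = a + n - i + 1 by ring,
    show a + b + 2 * ((n : ℝ) + 1) - (i + 1) + 1 = a + b + 2 * n + 2 - i by ring,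
    show a + b + 2 * ((n : ℝ) + 1) + j - 2 * (i + 1) + 2 = a + b + j + 2 * n - 2 * i + 2 by ring,
    show a + b + 2 * ((n : ℝ) + 1) + j - (i + 1) + 2 = a + b + 2 * n + j - i + 3 by ring,
    show a + b + 2 * (n : ℝ) - i + 1 = a + b + 2 * n + 1 - i by ring,
    show a + b + 2 * (n : ℝ) + j - 2 * i + 2 = a + b + j + 2 * n - 2 * i + 2 by ring,
    show a + (b + (n : ℝ) + 1) + (j - (i + 1) + 1) = a + b + j + n - i + 1 by ring,
    show a + (b + (n : ℝ) + 1) = a + b + n + 1 by ring,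
    show b + (n : ℝ) + 1 + (j - (i + 1) + 1) = b + j + n - i + 1 by ring,
    show a + b + (n : ℝ) + 1 + (n + 1) - (i + 1) + (j + 2) = a + b + 2 * n + j - i + 3 by ring,
    show a + b + (n : ℝ) + 1 + (n + 1) - (i + 1) + 1 + j = a + b + 2 * n + j - i + 2 by ring,
    show a + b + (n : ℝ) + 1 + (n + 1) - (i + 1) + 1 = a + b + 2 * n + 2 - i by ring,
    show a + b + (n : ℝ) + 1 + (n + 1) - (i + 1) = a + b + 2 * n + 1 - i by ring,
    show a + (n : ℝ) + 2 + -(i + 1) = a + n - i + 1 by ring,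
    show (n : ℝ) + 1 + 1 + -(i + 1) = n + 1 - i by ring,
    show (n : ℝ) + 1 + 1 = n + 2 by ring, f4, f5, f8,
    -- Two uses of the functional equation suffice: the first cancels the prefactor `a + b + 2n +
    -- 2`, the second produces the linear factor in the numerator of `coeffU`.
    gamma_add_one h5 (by ring : a + b + 2 * ((n : ℝ) + 1) + 1 = _),
    gamma_add_one h7 (by ring : a + b + (j : ℝ) + 2 * n - 2 * i + 2 = _),
    show a + b + (n : ℝ) + 1 + (n + 1) - 2 * (i + 1) + j + 1
      = a + b + j + 2 * n - 2 * i + 1 by ring]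
  have x5 := h5.ne'
  have x7 := h7.ne'
  generalize Real.Gamma (a + b + n + 1) = G1 at *
  generalize Real.Gamma (a + b + 2 * n + 1 - i) = G14 at *
  generalize Real.Gamma (a + b + 2 * n + 1) = G2 at *
  generalize Real.Gamma (a + n + 1) = G3 at *
  generalize Real.Gamma (b + n + 1) = G4 at *
  generalize Real.Gamma (a + b + 2 * n + 2 - i) = G12 at *
  generalize Real.Gamma (a + b + 2 * n + 2) = G5 at *
  generalize Real.Gamma (a + b + j + n - i + 1) = G6 at *
  generalize Real.Gamma (a + b + j + 2 * n - 2 * i + 1) = G7 at *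
  generalize Real.Gamma (a + n - i + 1) = G8 at *
  generalize Real.Gamma (b + j + n - i + 1) = G9 at *
  generalize Real.Gamma (a + n + 2) = G11 at *
  generalize Real.Gamma (a + b + 2 * n + j - i + 3) = G13 at *
  generalize Real.Gamma (a + b + 2 * n + j - i + 2) = G15 at *
  generalize a + b + 2 * (n : ℝ) + 2 = y5 at *
  generalize a + b + (j : ℝ) + 2 * n - 2 * i + 1 = y7 at *
  field_simp

/-! ### Laguerre polynomials -/

/-- The moment functional of the Laguerre weight `x^b e^{-x}` on `[0, ∞)`. -/
noncomputable def laguerreL (b : ℝ) : ℝ[X] →ₗ[ℝ] ℝ :=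
  momentFunctional fun k => Real.Gamma (b + k + 1)

/-- The monic Laguerre polynomials for the weight `x^b e^{-x}` on `[0, ∞)`. -/
noncomputable def laguerreP : ℕ → ℝ → ℝ[X]
  | 0, _ => 1
  | n + 1, b => C (-(1 + 0 * (n : ℝ))⁻¹) * raiseOp (b + 1) 1 0 (laguerreP n (b + 1))

/-- The squared norms of the monic Laguerre polynomials. -/
noncomputable def laguerreH (n : ℕ) (b : ℝ) : ℝ := n.factorial * Real.Gamma (b + n + 1)

theorem isPearson_laguerreL {b : ℝ} (hb : -1 < b) :
    IsPearson (laguerreL b) (pearsonSigma 0) (pearsonTau (b + 1) 1) := by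
  refine isPearson_of_moments fun k => ?_
  have hk : (0 : ℝ) ≤ k := k.cast_nonneg
  have h1 : 0 < b + k + 1 := by linarith
  rw [gamma_add_one h1 (by push_cast; ring : b + (k + 1 : ℕ) + 1 = _)]
  ring

theorem laguerreL_add_one {b : ℝ} (q : ℝ[X]) : laguerreL (b + 1) q = laguerreL b (X * q) := by
  have : laguerreL (b + 1) = (laguerreL b).comp (LinearMap.mulLeft ℝ X) := by
    refine linearMap_eq_of_monomial fun k => ?_
    simp only [LinearMap.comp_apply, LinearMap.mulLeft_apply, X_mul_monomial, laguerreL,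
      momentFunctional_monomial, one_mul]
    push_cast
    ring_nf
  rw [this]; rfl

theorem isMonicOrthogonalAt_laguerreP (n : ℕ) {b : ℝ} (hb : -1 < b) :
    IsMonicOrthogonalAt (laguerreL b) n (laguerreP n b) (laguerreH n b) := by
  induction n generalizing b with
  | zero =>
    have e : laguerreL b 1 = laguerreH 0 b := by
      rw [← monomial_zero_one, laguerreL, momentFunctional_monomial, laguerreH]
      simp
    rw [← e]
    refine isMonicOrthogonalAt_zero ?_
    rw [e, laguerreH]
    have h4 : 0 < b + (0 : ℕ) + 1 := by push_cast; linarith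
    have := Real.Gamma_pos_of_pos h4
    positivity
  | succ n ih =>
    have e : laguerreH (n + 1) b = (n + 1) / (1 + 0 * (n : ℝ)) * laguerreH n (b + 1) := by
      rw [laguerreH, laguerreH, Nat.factorial_succ]
      push_cast
      rw [show b + ((n : ℝ) + 1) + 1 = b + 1 + n + 1 by ring]
      ring
    rw [e]
    exact (ih (by linarith : -1 < b + 1)).raise (isPearson_laguerreL hb)
      (fun q => by rw [laguerreL_add_one, pearsonSigma]; simp) (by norm_num)

theorem isMonicOrthogonal_laguerreP {b : ℝ} (hb : -1 < b) :
    IsMonicOrthogonal (laguerreL b) (fun n => laguerreP n b) (fun n => laguerreH n b) :=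
  isMonicOrthogonal_of_forall fun n => isMonicOrthogonalAt_laguerreP n hb

theorem laguerreP_connection (n : ℕ) {b : ℝ} (hb : -1 < b) :
    laguerreP (n + 1) b = laguerreP (n + 1) (b + 1) + C ((n : ℝ) + 1) * laguerreP n (b + 1) := by
  rw [(isMonicOrthogonal_laguerreP hb).connection
    (isMonicOrthogonal_laguerreP (by linarith : -1 < b + 1)) laguerreL_add_one n]
  congr 3
  have hn : (0 : ℝ) ≤ n := n.cast_nonneg
  have h1 : 0 < b + 1 + n + 1 := by linarith
  have g1 := (Real.Gamma_pos_of_pos h1).ne'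
  rw [laguerreH, laguerreH, Nat.factorial_succ]
  push_cast
  rw [show b + ((n : ℝ) + 1) + 1 = b + 1 + n + 1 by ring]
  field_simp

/-- The coefficient of the Laguerre polynomial of degree `n - i` for the weight `x^b e^{-x}` in the
one of degree `n` for the weight `x^(b+k) e^{-x}`. -/
noncomputable def laguerreC (k n i : ℕ) : ℝ :=
  (-1) ^ i * n.descFactorial i * (k + i - 1).choose i

/-- Here the parameter is lowered, so `laguerreP_connection` is solved for the polynomial with the
larger parameter. This gives a double induction, on `k` and on the degree, closed by Pascal's rule.
-/
theorem laguerreP_expansion {b : ℝ} (hb : -1 < b) (k n : ℕ) :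
    laguerreP n (b + k) = ∑ i ∈ Finset.range (n + 1), C (laguerreC k n i) * laguerreP (n - i) b := by
  induction k generalizing n with
  | zero =>
    -- For `k = 0` truncated subtraction gives `choose (i - 1) i`, which is `1` at `i = 0` and `0`
    -- afterwards, as required.
    rw [Finset.sum_range_succ', Finset.sum_eq_zero]
    · simp [laguerreC]
    · intro i _
      simp [laguerreC]
  | succ k ih =>
    induction n with
    | zero => simp [laguerreP, laguerreC]
    | succ n ihn =>
      have hbk : -1 < b + k := by have : (0 : ℝ) ≤ k := k.cast_nonneg
                                  linarith
      have h := laguerreP_connection n hbk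
      rw [add_assoc b (k : ℝ) 1, ← Nat.cast_succ, ihn, ih (n + 1)] at h
      rw [← sub_eq_iff_eq_add] at h
      rw [← h, Finset.sum_range_succ', Finset.sum_range_succ' _ (n + 1), Finset.mul_sum,
        add_sub_right_comm, ← Finset.sum_sub_distrib]
      congr 1
      · refine Finset.sum_congr rfl fun i _ => ?_
        rw [show n + 1 - (i + 1) = n - i by omega, ← mul_assoc, ← sub_mul, ← C_mul, ← C_sub]
        congr 2
        rw [laguerreC, laguerreC, laguerreC, Nat.succ_descFactorial_succ,
          show k + 1 + (i + 1) - 1 = k + i + 1 by omega, show k + (i + 1) - 1 = k + i by omega,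
          show k + 1 + i - 1 = k + i by omega, Nat.choose_succ_succ]
        push_cast
        ring
      · simp [laguerreC]

/-- The polynomials belong to `x^(b+k) e^{-x}`, and `laguerreL b` plays the role of testing against
`x^(-k)`. Their Pearson coefficient `τ` exceeds that of `laguerreL b` by the constant `k`, whence
the factor `k` on the left. -/
theorem laguerre_sum (n k : ℕ) {b : ℝ} (hb : -1 < b) :
    k * ∑ i ∈ Finset.range (n + 1),
        laguerreL b (laguerreP i (b + k) * laguerreP i (b + k)) / laguerreH i (b + k)
      = ∑ j ∈ Finset.range (n + 1), ((k + j - 1).choose j : ℝ) * (k + j).choose (j + 1) *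
        (Real.Gamma (b + n - j + 1) / Real.Gamma (b + k + n + 1) *
          ((n + 1).factorial / (n - j).factorial)) := by
  have hk : (0 : ℝ) ≤ k := k.cast_nonneg
  have hn : (0 : ℝ) ≤ n := n.cast_nonneg
  have hbk : -1 < b + k := by linarith
  have hP := isPearson_laguerreL hb
  have key := (isMonicOrthogonal_laguerreP hbk).sum_skewOp (isPearson_laguerreL hbk)
    (natDegree_pearsonSigma_le _) (natDegree_pearsonTau_le _ _) (laguerreL b) n
  rw [skewCoeff_pearson, laguerreP_expansion hb k (n + 1), laguerreP_expansion hb k n,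
    (isMonicOrthogonal_laguerreP hb).apply_expansion n] at key
  have e : ∀ i, laguerreL b (skewOp (pearsonSigma 0) (pearsonTau (b + k + 1) 1)
        (laguerreP i (b + k)) * laguerreP i (b + k)) / laguerreH i (b + k)
      = k * (laguerreL b (laguerreP i (b + k) * laguerreP i (b + k)) / laguerreH i (b + k)) := by
    intro i
    set P := laguerreP i (b + k)
    have e1 : skewOp (pearsonSigma 0) (pearsonTau (b + k + 1) 1) P * P
        = (pearsonTau (b + 1) 1 * (P * P) + pearsonSigma 0 * derivative (P * P))
          + (k : ℝ) • (P * P) := by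
      simp only [skewOp, pearsonTau, derivative_mul, smul_eq_C_mul, C_add]
      ring
    rw [e1, map_add, hP, map_smul, zero_add, smul_eq_mul, mul_div_assoc]
  rw [Finset.sum_congr rfl fun i _ => e i, ← Finset.mul_sum] at key
  rw [key, Finset.mul_sum]
  refine Finset.sum_congr rfl fun j hj => ?_
  rw [Finset.mem_range] at hj
  have hj' : j ≤ n := by omega
  have f2 : ((n - j).factorial : ℝ) * n.descFactorial j = n.factorial := by
    exact_mod_cast Nat.factorial_mul_descFactorial hj'
  have f1 : ((n - j).factorial : ℝ) ≠ 0 := by positivity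
  have f3 : (n.descFactorial j : ℝ) = n.factorial / (n - j).factorial := by
    rw [← f2]; field_simp
  have h1 : 0 < b + k + n + 1 := by linarith
  have g1 := (Real.Gamma_pos_of_pos h1).ne'
  have hs : ((-1 : ℝ) ^ j) * (-1) ^ j = 1 := by rw [← mul_pow]; simp
  rw [laguerreC, laguerreC, laguerreH, laguerreH, Nat.succ_descFactorial_succ, Nat.factorial_succ,
    show k + (j + 1) - 1 = k + j by omega]
  push_cast [Nat.cast_sub hj']
  rw [f3, show b + ((n : ℝ) - j) + 1 = b + n - j + 1 by ring, pow_succ]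
  have f6 : (n.factorial : ℝ) ≠ 0 := by positivity
  field_simp
  linear_combination Real.Gamma (b + n - j + 1) * (k + j - 1).choose j * ((k + j).choose (j + 1) : ℝ) * hs

/-! ### One-point functions of unitary ensembles -/

/-- The `p i` are monic of degree `i`, so they may replace the powers in the Vandermonde
determinant; both factors of its square are then expanded by Leibniz. -/
theorem jointDensity_two_eq_sum {L : ℝ[X] →ₗ[ℝ] ℝ} {p : ℕ → ℝ[X]} {h : ℕ → ℝ}
    (H : IsMonicOrthogonal L p h) (w : ℝ → ℝ) (n : ℕ) (x : Fin n → ℝ) :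
    jointDensity 2 w n x = ∑ σ : Equiv.Perm (Fin n), ∑ τ : Equiv.Perm (Fin n),
      ((Equiv.Perm.sign σ : ℤ) : ℝ) * ((Equiv.Perm.sign τ : ℤ) : ℝ) *
        ∏ j, ((p (σ j) * p (τ j)).eval (x j) * w (x j)) := by
  have h1 : ∏ j, ∏ k ∈ Finset.Ioi j, |x k - x j| ^ (2 : ℝ)
      = (Matrix.of fun i j : Fin n => (p j).eval (x i)).transpose.det ^ 2 := by
    rw [Matrix.det_transpose, ← Matrix.det_eval_matrixOfPolynomials_eq_det_vandermonde x
      (fun i => p i) (fun i => H.natDegree_eq i) (fun i => H.monic i), Matrix.det_vandermonde,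
      ← Finset.prod_pow]
    refine Finset.prod_congr rfl fun j _ => ?_
    rw [← Finset.prod_pow]
    refine Finset.prod_congr rfl fun k _ => ?_
    rw [← sq_abs (x k - x j)]
    exact_mod_cast Real.rpow_natCast |x k - x j| 2
  rw [jointDensity, h1, Matrix.det_apply', sq, Finset.sum_mul_sum, Finset.mul_sum]
  refine Finset.sum_congr rfl fun σ _ => ?_
  rw [Finset.mul_sum]
  refine Finset.sum_congr rfl fun τ _ => ?_
  simp only [Matrix.transpose_apply, Matrix.of_apply, eval_mul, Finset.prod_mul_distrib]
  ring

theorem volume_restrict_cube (I : Set ℝ) (n : ℕ) :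
    (volume : Measure (Fin n → ℝ)).restrict (cube I n)
      = Measure.pi fun _ => volume.restrict I := by
  rw [cube, volume_pi, Measure.restrict_pi_pi]

theorem prod_apply_perm {L : ℝ[X] →ₗ[ℝ] ℝ} {p : ℕ → ℝ[X]} {h : ℕ → ℝ}
    (H : IsMonicOrthogonal L p h) {n : ℕ} (σ τ : Equiv.Perm (Fin n)) :
    ∏ j, L (p (σ j) * p (τ j)) = if σ = τ then ∏ i ∈ Finset.range n, h i else 0 := by
  split_ifs with hst
  · subst hst
    rw [← Fin.prod_univ_eq_prod_range, ← Equiv.prod_comp σ fun i : Fin n => h i]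
    exact Finset.prod_congr rfl fun j _ => H.apply_self _
  · obtain ⟨j, hj⟩ : ∃ j, σ j ≠ τ j := by
      by_contra! hc
      exact hst (Equiv.ext hc)
    exact Finset.prod_eq_zero (Finset.mem_univ j)
      (H.apply_mul_of_ne fun hc => hj (Fin.ext hc))

theorem prod_ite_apply_perm {L L' : ℝ[X] →ₗ[ℝ] ℝ} {p : ℕ → ℝ[X]} {h : ℕ → ℝ}
    (H : IsMonicOrthogonal L p h) {n : ℕ} (σ τ : Equiv.Perm (Fin n)) (l : Fin n) :
    ∏ j, (if j = l then L' (p (σ j) * p (τ j)) else L (p (σ j) * p (τ j)))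
      = if σ = τ then (∏ i ∈ Finset.range n, h i) * (L' (p (σ l) * p (σ l)) / h (σ l))
        else 0 := by
  split_ifs with hst
  · subst hst
    rw [← Fin.prod_univ_eq_prod_range, ← Equiv.prod_comp σ fun i : Fin n => h i,
      ← Finset.mul_prod_erase Finset.univ _ (Finset.mem_univ l),
      ← Finset.mul_prod_erase Finset.univ (fun j => h (σ j)) (Finset.mem_univ l), if_pos rfl]
    have : ∏ j ∈ Finset.univ.erase l,
        (if j = l then L' (p (σ j) * p (σ j)) else L (p (σ j) * p (σ j)))
        = ∏ j ∈ Finset.univ.erase l, h (σ j) := by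
      refine Finset.prod_congr rfl fun j hj => ?_
      rw [if_neg (Finset.ne_of_mem_erase hj), H.apply_self]
    rw [this]
    have := (H.norm_pos (σ l)).ne'
    field_simp
  · obtain ⟨j, hjl, hj⟩ : ∃ j, j ≠ l ∧ σ j ≠ τ j := by
      by_contra! hc
      apply hst
      -- Permutations that agree off `l` agree at `l`: otherwise `σ⁻¹ (τ l)` is another point that
      -- `τ` sends to `τ l`.
      have hl : σ l = τ l := by
        by_cases hj : σ.symm (τ l) = l
        · rw [← hj, Equiv.apply_symm_apply, hj]
        · have := hc _ hj
          rw [Equiv.apply_symm_apply] at this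
          exact absurd (τ.injective this).symm hj
      ext j
      by_cases hjl : j = l
      · rw [hjl, hl]
      · rw [hc j hjl]
    refine Finset.prod_eq_zero (Finset.mem_univ j) ?_
    rw [if_neg hjl, H.apply_mul_of_ne fun hc => hj (Fin.ext hc)]

theorem sum_sign_mul_ite {n : ℕ} (F : Equiv.Perm (Fin n) → ℝ) :
    ∑ σ : Equiv.Perm (Fin n), ∑ τ : Equiv.Perm (Fin n),
      ((Equiv.Perm.sign σ : ℤ) : ℝ) * ((Equiv.Perm.sign τ : ℤ) : ℝ) * (if σ = τ then F σ else 0)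
      = ∑ σ, F σ := by
  refine Finset.sum_congr rfl fun σ _ => ?_
  rw [Finset.sum_eq_single σ]
  · rw [if_pos rfl, ← Int.cast_mul, Int.units_coe_mul_self, Int.cast_one, one_mul]
  · intro τ _ hτ
    rw [if_neg hτ.symm, mul_zero]
  · exact fun hc => absurd (Finset.mem_univ _) hc

/-- The moments of a unitary ensemble, as integrals against the Christoffel–Darboux kernel on the
diagonal. -/
theorem momentExists_and_ensembleMoment_eq {w : ℝ → ℝ} {I : Set ℝ} {L L' : ℝ[X] →ₗ[ℝ] ℝ}
    {p : ℕ → ℝ[X]} {h : ℕ → ℝ} (H : IsMonicOrthogonal L p h) (k : ℤ) (n : ℕ)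
    (hw : ∀ q : ℝ[X], IntegrableOn (fun x => q.eval x * w x) I ∧
      ∫ x in I, q.eval x * w x = L q)
    (hw' : ∀ q : ℝ[X], IntegrableOn (fun x => x ^ k * (q.eval x * w x)) I ∧
      ∫ x in I, x ^ k * (q.eval x * w x) = L' q) :
    MomentExists 2 w I k n ∧
      ensembleMoment 2 w I k n = ∑ i ∈ Finset.range n, L' (p i * p i) / h i := by
  have int1 : ∀ σ τ : Equiv.Perm (Fin n), Integrable (fun x : Fin n → ℝ =>
      ((Equiv.Perm.sign σ : ℤ) : ℝ) * ((Equiv.Perm.sign τ : ℤ) : ℝ) *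
        ∏ j, ((p (σ j) * p (τ j)).eval (x j) * w (x j)))
      (Measure.pi fun _ => volume.restrict I) := fun σ τ =>
    (Integrable.fintype_prod (f := fun j y => (p (σ j) * p (τ j)).eval y * w y)
      fun j => (hw _).1).const_mul _
  -- The power `x l ^ k` is absorbed into the factor of the variable `x l`, so the integrand stays a
  -- product and Fubini applies.
  have hprod : ∀ (σ τ : Equiv.Perm (Fin n)) (l : Fin n) (x : Fin n → ℝ),
      x l ^ k * ∏ j, ((p (σ j) * p (τ j)).eval (x j) * w (x j))
        = ∏ j, (if j = l then fun y => y ^ k * ((p (σ j) * p (τ j)).eval y * w y)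
            else fun y => (p (σ j) * p (τ j)).eval y * w y) (x j) := by
    intro σ τ l x
    rw [← Finset.mul_prod_erase Finset.univ _ (Finset.mem_univ l),
      ← Finset.mul_prod_erase Finset.univ (fun j => (if j = l then
        fun y => y ^ k * ((p (σ j) * p (τ j)).eval y * w y)
          else fun y => (p (σ j) * p (τ j)).eval y * w y) (x j)) (Finset.mem_univ l), if_pos rfl,
      ← mul_assoc]
    congr 1
    refine Finset.prod_congr rfl fun j hj => ?_
    rw [if_neg (Finset.ne_of_mem_erase hj)]
  have hden : ∀ x : Fin n → ℝ, (∑ j, x j ^ k) * jointDensity 2 w n x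
      = ∑ σ : Equiv.Perm (Fin n), ∑ τ : Equiv.Perm (Fin n), ∑ l,
        ((Equiv.Perm.sign σ : ℤ) : ℝ) * ((Equiv.Perm.sign τ : ℤ) : ℝ) *
        ∏ j, (if j = l then fun y => y ^ k * ((p (σ j) * p (τ j)).eval y * w y)
            else fun y => (p (σ j) * p (τ j)).eval y * w y) (x j) := by
    intro x
    rw [jointDensity_two_eq_sum H, Finset.mul_sum]
    refine Finset.sum_congr rfl fun σ _ => ?_
    rw [Finset.mul_sum]
    refine Finset.sum_congr rfl fun τ _ => ?_
    rw [Finset.sum_mul]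
    refine Finset.sum_congr rfl fun l _ => ?_
    rw [← hprod]
    ring
  have int2 : ∀ (σ τ : Equiv.Perm (Fin n)) (l : Fin n), Integrable (fun x : Fin n → ℝ =>
      ((Equiv.Perm.sign σ : ℤ) : ℝ) * ((Equiv.Perm.sign τ : ℤ) : ℝ) *
        ∏ j, (if j = l then fun y => y ^ k * ((p (σ j) * p (τ j)).eval y * w y)
            else fun y => (p (σ j) * p (τ j)).eval y * w y) (x j))
      (Measure.pi fun _ => volume.restrict I) := by
    refine fun σ τ l => Integrable.const_mul (Integrable.fintype_prod fun j => ?_) _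
    split_ifs
    · exact (hw' _).1
    · exact (hw _).1
  have hN : normConst 2 w I n = n.factorial * ∏ i ∈ Finset.range n, h i := by
    rw [normConst, volume_restrict_cube]
    simp only [jointDensity_two_eq_sum H]
    rw [integral_finsetSum _ fun σ _ => integrable_finsetSum _ fun τ _ => int1 σ τ]
    simp only [integral_finsetSum _ fun τ _ => int1 _ τ, integral_const_mul]
    have : ∀ σ τ : Equiv.Perm (Fin n), ∫ x : Fin n → ℝ,
        ∏ j, ((p (σ j) * p (τ j)).eval (x j) * w (x j)) ∂(Measure.pi fun _ => volume.restrict I)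
        = if σ = τ then ∏ i ∈ Finset.range n, h i else 0 := by
      intro σ τ
      rw [integral_fintype_prod_eq_prod (fun j y => (p (σ j) * p (τ j)).eval y * w y),
        ← prod_apply_perm H]
      exact Finset.prod_congr rfl fun j _ => (hw _).2
    simp only [this]
    rw [sum_sign_mul_ite fun _ => ∏ i ∈ Finset.range n, h i, Finset.sum_const, Finset.card_univ,
      Fintype.card_perm, Fintype.card_fin, nsmul_eq_mul]
  have hpos : 0 < ∏ i ∈ Finset.range n, h i := Finset.prod_pos fun i _ => H.norm_pos i
  have hM : ∫ x in cube I n, (∑ j, x j ^ k) * jointDensity 2 w n x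
      = (n.factorial * ∏ i ∈ Finset.range n, h i)
        * ∑ i ∈ Finset.range n, L' (p i * p i) / h i := by
    rw [volume_restrict_cube]
    simp only [hden]
    rw [integral_finsetSum _ fun σ _ => integrable_finsetSum _ fun τ _ =>
      integrable_finsetSum _ fun l _ => int2 σ τ l]
    have : ∀ σ τ : Equiv.Perm (Fin n), ∀ l, ∫ x : Fin n → ℝ,
        ∏ j, (if j = l then fun y => y ^ k * ((p (σ j) * p (τ j)).eval y * w y)
            else fun y => (p (σ j) * p (τ j)).eval y * w y) (x j)
          ∂(Measure.pi fun _ => volume.restrict I)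
        = if σ = τ then (∏ i ∈ Finset.range n, h i) * (L' (p (σ l) * p (σ l)) / h (σ l))
          else 0 := by
      intro σ τ l
      rw [integral_fintype_prod_eq_prod (fun j => (if j = l then
        fun y => y ^ k * ((p (σ j) * p (τ j)).eval y * w y)
            else fun y => (p (σ j) * p (τ j)).eval y * w y)), ← prod_ite_apply_perm H]
      refine Finset.prod_congr rfl fun j _ => ?_
      split_ifs
      · exact (hw' _).2
      · exact (hw _).2
    simp only [integral_finsetSum _ fun τ _ => integrable_finsetSum _ fun l _ => int2 _ τ l,
      integral_finsetSum _ fun l _ => int2 _ _ l, integral_const_mul, this]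
    simp only [← Finset.mul_sum]
    -- Reindexing `l` by `σ` removes the dependence on `σ`, so all `n!` permutations contribute
    -- equally.
    have e : ∀ σ τ : Equiv.Perm (Fin n), (∑ l, if σ = τ then (∏ i ∈ Finset.range n, h i) *
        (L' (p (σ l) * p (σ l)) / h (σ l)) else 0) = if σ = τ then (∏ i ∈ Finset.range n, h i) *
          ∑ i ∈ Finset.range n, L' (p i * p i) / h i else 0 := by
      intro σ τ
      split_ifs
      · rw [← Finset.mul_sum, ← Fin.sum_univ_eq_sum_range (fun i => L' (p i * p i) / h i),
          Equiv.sum_comp σ fun i : Fin n => L' (p i * p i) / h i]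
      · simp
    simp only [e]
    rw [sum_sign_mul_ite fun _ => (∏ i ∈ Finset.range n, h i) *
          ∑ i ∈ Finset.range n, L' (p i * p i) / h i, Finset.sum_const, Finset.card_univ,
      Fintype.card_perm, Fintype.card_fin, nsmul_eq_mul, mul_assoc]
  have hpos' : 0 < (n.factorial : ℝ) * ∏ i ∈ Finset.range n, h i := by positivity
  refine ⟨⟨?_, hN ▸ hpos', ?_⟩, ?_⟩
  · rw [IntegrableOn, volume_restrict_cube]
    simp only [funext (jointDensity_two_eq_sum H w n)]
    exact integrable_finsetSum _ fun σ _ => integrable_finsetSum _ fun τ _ => int1 σ τ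
  · rw [IntegrableOn, volume_restrict_cube]
    simp only [hden]
    exact integrable_finsetSum _ fun σ _ => integrable_finsetSum _ fun τ _ =>
      integrable_finsetSum _ fun l _ => int2 σ τ l
  · rw [ensembleMoment, hN, hM]
    field_simp

/-! ### Integrals against the Jacobi and Laguerre weights -/

theorem integral_eval_mul {w : ℝ → ℝ} {I : Set ℝ} {μ : ℕ → ℝ}
    (hw : ∀ j : ℕ, IntegrableOn (fun x => x ^ j * w x) I ∧ ∫ x in I, x ^ j * w x = μ j)
    (q : ℝ[X]) : IntegrableOn (fun x => q.eval x * w x) I ∧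
      ∫ x in I, q.eval x * w x = momentFunctional μ q := by
  induction q using Polynomial.induction_on' with
  | add p q hp hq =>
    simp only [eval_add, add_mul, map_add]
    exact ⟨hp.1.add hq.1, by rw [integral_add hp.1 hq.1, hp.2, hq.2]⟩
  | monomial k c =>
    simp only [eval_monomial, mul_assoc, momentFunctional_monomial]
    exact ⟨(hw k).1.const_mul c, by rw [integral_const_mul, (hw k).2]⟩

/-- That the Beta density has total mass one gives both the integrability and the value. -/
theorem integral_beta {α β : ℝ} (hα : 0 < α) (hβ : 0 < β) :
    IntegrableOn (fun x : ℝ => x ^ (α - 1) * (1 - x) ^ (β - 1)) (Set.Icc 0 1) ∧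
      ∫ x in Set.Icc (0 : ℝ) 1, x ^ (α - 1) * (1 - x) ^ (β - 1)
        = Real.Gamma α * Real.Gamma β / Real.Gamma (α + β) := by
  have hB := ProbabilityTheory.beta_pos hα hβ
  have h1 : ∫⁻ x : ℝ in Set.Ioo 0 1, ENNReal.ofReal (1 / ProbabilityTheory.beta α β *
      (x ^ (α - 1) * (1 - x) ^ (β - 1))) = 1 := by
    simp only [← mul_assoc]
    rw [← ProbabilityTheory.lintegral_betaPDF, ProbabilityTheory.lintegral_betaPDF_eq_one hα hβ]
  have hpos : 0 ≤ᵐ[volume.restrict (Set.Ioo (0 : ℝ) 1)] fun x : ℝ =>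
      1 / ProbabilityTheory.beta α β * (x ^ (α - 1) * (1 - x) ^ (β - 1)) := by
    refine ae_restrict_of_forall_mem measurableSet_Ioo fun x hx => ?_
    have h2 := Real.rpow_pos_of_pos hx.1 (α - 1)
    have h3 := Real.rpow_pos_of_pos (sub_pos.2 hx.2) (β - 1)
    change (0 : ℝ) ≤ _
    positivity
  have hm : AEStronglyMeasurable (fun x : ℝ =>
      1 / ProbabilityTheory.beta α β * (x ^ (α - 1) * (1 - x) ^ (β - 1)))
      (volume.restrict (Set.Ioo (0 : ℝ) 1)) :=
    Measurable.aestronglyMeasurable (by fun_prop)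
  have hint : IntegrableOn (fun x : ℝ =>
      1 / ProbabilityTheory.beta α β * (x ^ (α - 1) * (1 - x) ^ (β - 1))) (Set.Ioo (0 : ℝ) 1) :=
    (lintegral_ofReal_ne_top_iff_integrable hm hpos).1 (by rw [h1]; exact ENNReal.one_ne_top)
  have hval := integral_eq_lintegral_of_nonneg_ae hpos hm
  rw [h1, ENNReal.toReal_one, integral_const_mul] at hval
  have e : (fun x : ℝ => x ^ (α - 1) * (1 - x) ^ (β - 1)) = fun x =>
      ProbabilityTheory.beta α β *
        (1 / ProbabilityTheory.beta α β * (x ^ (α - 1) * (1 - x) ^ (β - 1))) := by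
    funext x
    field_simp
  refine ⟨?_, ?_⟩
  · rw [integrableOn_Icc_iff_integrableOn_Ioo, e]
    exact hint.const_mul _
  · rw [integral_Icc_eq_integral_Ioo]
    change _ = ProbabilityTheory.beta α β
    field_simp at hval
    exact hval

theorem jacobiWeight_two (a b : ℝ) : jacobiWeight 2 a b = fun x => x ^ b * (1 - x) ^ a := by
  funext x
  rw [jacobiWeight]
  congr 2 <;> ring

theorem integral_eval_mul_jacobiWeight {a b : ℝ} (ha : -1 < a) (hb : 0 ≤ b) (q : ℝ[X]) :
    IntegrableOn (fun x => q.eval x * jacobiWeight 2 a b x) (Set.Icc 0 1) ∧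
      ∫ x in Set.Icc 0 1, q.eval x * jacobiWeight 2 a b x = jacobiL a b q := by
  refine integral_eval_mul (fun j => ?_) q
  have hj : (0 : ℝ) ≤ j := j.cast_nonneg
  obtain ⟨h1, h2⟩ := integral_beta (by linarith : 0 < b + j + 1) (by linarith : 0 < a + 1)
  have e : Set.EqOn (fun x : ℝ => x ^ (b + j + 1 - 1) * (1 - x) ^ (a + 1 - 1))
      (fun x => x ^ j * jacobiWeight 2 a b x) (Set.Icc 0 1) := by
    intro x hx
    simp only [jacobiWeight_two, add_sub_cancel_right]
    -- Nonnegative exponents make the splitting valid at the endpoint `x = 0` too.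
    rw [Real.rpow_add_of_nonneg hx.1 hb hj, Real.rpow_natCast]
    ring
  refine ⟨h1.congr_fun e measurableSet_Icc, ?_⟩
  rw [← setIntegral_congr_fun measurableSet_Icc e, h2, jacobiMu, mul_comm (Real.Gamma (a + 1))]
  congr 2
  ring

theorem laguerreWeight_two (b : ℝ) : laguerreWeight 2 b = fun x => x ^ b * Real.exp (-x) := by
  funext x
  rw [laguerreWeight]
  congr 2 <;> ring

theorem integral_eval_mul_laguerreWeight {b : ℝ} (hb : 0 ≤ b) (q : ℝ[X]) :
    IntegrableOn (fun x => q.eval x * laguerreWeight 2 b x) (Set.Ici 0) ∧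
      ∫ x in Set.Ici 0, q.eval x * laguerreWeight 2 b x = laguerreL b q := by
  refine integral_eval_mul (fun j => ?_) q
  have hj : (0 : ℝ) ≤ j := j.cast_nonneg
  have hpos : 0 < b + j + 1 := by linarith
  have h1 := Real.GammaIntegral_convergent hpos
  have h2 := Real.Gamma_eq_integral hpos
  rw [← integrableOn_Ici_iff_integrableOn_Ioi] at h1
  rw [← integral_Ici_eq_integral_Ioi] at h2
  have e : Set.EqOn (fun x : ℝ => Real.exp (-x) * x ^ (b + j + 1 - 1))
      (fun x => x ^ j * laguerreWeight 2 b x) (Set.Ici 0) := by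
    intro x hx
    simp only [laguerreWeight_two, add_sub_cancel_right]
    rw [Real.rpow_add_of_nonneg hx hb hj, Real.rpow_natCast]
    ring
  exact ⟨h1.congr_fun e measurableSet_Ici, by rw [← setIntegral_congr_fun measurableSet_Ici e, h2]⟩

theorem integral_zpow_mul_laguerreWeight {b : ℝ} (hb : 0 ≤ b) (k : ℕ) (q : ℝ[X]) :
    IntegrableOn (fun x => x ^ (-(k : ℤ)) * (q.eval x * laguerreWeight 2 (b + k) x)) (Set.Ici 0) ∧
      ∫ x in Set.Ici 0, x ^ (-(k : ℤ)) * (q.eval x * laguerreWeight 2 (b + k) x)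
        = laguerreL b q := by
  obtain ⟨h1, h2⟩ := integral_eval_mul_laguerreWeight hb q
  -- The identity is taken on the open half-line: at `0` the power `x ^ (-k)` has the default value
  -- `0` when `k > 0`. The endpoint is a null set.
  have e : Set.EqOn (fun x => q.eval x * laguerreWeight 2 b x)
      (fun x => x ^ (-(k : ℤ)) * (q.eval x * laguerreWeight 2 (b + k) x)) (Set.Ioi 0) := by
    intro x hx
    have hx' : (0 : ℝ) < x := hx
    have := (pow_pos hx' k).ne'
    simp only [laguerreWeight_two]
    rw [Real.rpow_add hx', Real.rpow_natCast, zpow_neg, zpow_natCast]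
    field_simp
  rw [integrableOn_Ici_iff_integrableOn_Ioi] at h1 ⊢
  rw [integral_Ici_eq_integral_Ioi] at h2 ⊢
  exact ⟨h1.congr_fun e measurableSet_Ioi, by rw [← setIntegral_congr_fun measurableSet_Ioi e, h2]⟩

theorem jacobi_moment {a b : ℝ} (ha : -1 < a) (hb : 0 ≤ b) (k n : ℕ) :
    MomentExists 2 (jacobiWeight 2 a b) (Set.Icc 0 1) k n ∧
      jacobiMoment 2 a b k n = jacobiS a b n k := by
  refine momentExists_and_ensembleMoment_eq (isMonicOrthogonal_jacobiP ha hb) k n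
    (L' := (jacobiL a b).comp (LinearMap.mulLeft ℝ (X ^ k)))
    (integral_eval_mul_jacobiWeight ha hb) fun q => ?_
  have := integral_eval_mul_jacobiWeight ha hb (X ^ k * q)
  simpa only [eval_mul, eval_pow, eval_X, mul_assoc, zpow_natCast, LinearMap.comp_apply,
    LinearMap.mulLeft_apply] using this

theorem laguerre_moment {b : ℝ} (hb : 0 ≤ b) (k n : ℕ) :
    MomentExists 2 (laguerreWeight 2 (b + k)) (Set.Ici 0) (-(k : ℤ)) n ∧
      laguerreMoment 2 (b + k) (-(k : ℤ)) n = ∑ i ∈ Finset.range n,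
        laguerreL b (laguerreP i (b + k) * laguerreP i (b + k)) / laguerreH i (b + k) := by
  have hk : (0 : ℝ) ≤ k := k.cast_nonneg
  exact momentExists_and_ensembleMoment_eq
    (isMonicOrthogonal_laguerreP (by linarith : -1 < b + k)) _ n
    (integral_eval_mul_laguerreWeight (by linarith)) (integral_zpow_mul_laguerreWeight hb k)

/-! ### Rescaling of an ensemble -/

open scoped Pointwise in
-- After `y = r x` the Jacobian and the constant `A` enter both the integral and the normalisation
-- and cancel, leaving `r ^ (-k)`.
theorem ensembleMoment_scale {w w' : ℝ → ℝ} {I : Set ℝ} {r c : ℝ} (hr : 0 < r) (hc : 0 < c)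
    (hI : ∀ x, r * x ∈ I ↔ x ∈ I) (hIm : MeasurableSet I)
    (hw : ∀ x ∈ I, w' x = c * w (r * x)) (k : ℤ) (n : ℕ) (hE : MomentExists 2 w I k n) :
    MomentExists 2 w' I k n ∧ ensembleMoment 2 w' I k n = r ^ (-k) * ensembleMoment 2 w I k n := by
  set A : ℝ := c ^ n * (∏ j : Fin n, ∏ _k ∈ Finset.Ioi j, r ^ (2 : ℝ))⁻¹ with hA
  have hB : 0 < ∏ j : Fin n, ∏ _k ∈ Finset.Ioi j, r ^ (2 : ℝ) :=
    Finset.prod_pos fun j _ => Finset.prod_pos fun _ _ => Real.rpow_pos_of_pos hr 2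
  have hApos : 0 < A := by positivity
  have hmem : ∀ x : Fin n → ℝ, r • x ∈ cube I n ↔ x ∈ cube I n := by
    intro x
    simp [cube, hI]
  have hcm : MeasurableSet (cube I n) := MeasurableSet.univ_pi fun _ => hIm
  have hsmul : r • cube I n = cube I n := by
    ext x
    rw [Set.mem_smul_set_iff_inv_smul_mem₀ hr.ne', ← hmem, smul_inv_smul₀ hr.ne']
  have hd : Set.EqOn (jointDensity 2 w' n) (fun x => A * jointDensity 2 w n (r • x))
      (cube I n) := by
    intro x hx
    have h1 : ∏ j, w' (x j) = c ^ n * ∏ j, w (r * x j) := by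
      rw [Finset.prod_congr rfl fun j _ => hw (x j) (hx j (Set.mem_univ j)),
        Finset.prod_mul_distrib, Finset.prod_const, Finset.card_univ, Fintype.card_fin]
    have h2 : ∏ j, ∏ k ∈ Finset.Ioi j, |(r • x) k - (r • x) j| ^ (2 : ℝ)
        = (∏ j : Fin n, ∏ _k ∈ Finset.Ioi j, r ^ (2 : ℝ))
          * ∏ j, ∏ k ∈ Finset.Ioi j, |x k - x j| ^ (2 : ℝ) := by
      rw [← Finset.prod_mul_distrib]
      refine Finset.prod_congr rfl fun j _ => ?_
      rw [← Finset.prod_mul_distrib]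
      refine Finset.prod_congr rfl fun k _ => ?_
      rw [← Real.mul_rpow hr.le (abs_nonneg _), Pi.smul_apply, Pi.smul_apply, smul_eq_mul,
        smul_eq_mul, ← mul_sub, abs_mul, abs_of_pos hr]
    simp only [jointDensity]
    rw [h1, h2, hA]
    simp only [Pi.smul_apply, smul_eq_mul]
    field_simp
  have hm : Set.EqOn (fun x => (∑ j, x j ^ k) * jointDensity 2 w' n x)
      (fun x => r ^ (-k) * A * ((fun y : Fin n → ℝ =>
        (∑ j, y j ^ k) * jointDensity 2 w n y) (r • x))) (cube I n) := by
    intro x hx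
    have h1 : ∑ j, (r • x) j ^ k = r ^ k * ∑ j, x j ^ k := by
      rw [Finset.mul_sum]
      exact Finset.sum_congr rfl fun j _ => by rw [Pi.smul_apply, smul_eq_mul, mul_zpow]
    have h2 := zpow_ne_zero k hr.ne'
    simp only
    rw [hd hx, h1, zpow_neg]
    field_simp
  have hint : ∀ f : (Fin n → ℝ) → ℝ, IntegrableOn f (cube I n) →
      IntegrableOn (fun x => f (r • x)) (cube I n) := by
    intro f hf
    rw [← integrable_indicator_iff hcm] at hf ⊢
    have e : (cube I n).indicator (fun x => f (r • x))
        = fun x => (cube I n).indicator f (r • x) := by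
      funext x
      by_cases hx : x ∈ cube I n <;> simp [hmem, hx]
    rw [e]
    exact hf.comp_smul hr.ne'
  obtain ⟨h1, h2, h3⟩ := hE
  have hR : 0 < (r ^ Module.finrank ℝ (Fin n → ℝ))⁻¹ := by positivity
  have hN : normConst 2 w' I n
      = A * (r ^ Module.finrank ℝ (Fin n → ℝ))⁻¹ * normConst 2 w I n := by
    rw [normConst, setIntegral_congr_fun hcm hd, integral_const_mul,
      Measure.setIntegral_comp_smul_of_pos volume _ _ hr, hsmul, smul_eq_mul, normConst]
    ring
  refine ⟨⟨IntegrableOn.congr_fun ((hint _ h1).const_mul A) hd.symm hcm, ?_,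
    IntegrableOn.congr_fun ((hint _ h3).const_mul _) hm.symm hcm⟩, ?_⟩
  · rw [hN]; positivity
  · rw [ensembleMoment, ensembleMoment, hN, setIntegral_congr_fun hcm hm, integral_const_mul,
      Measure.setIntegral_comp_smul_of_pos volume
        (fun y : Fin n → ℝ => (∑ j, y j ^ k) * jointDensity 2 w n y) _ hr, hsmul, smul_eq_mul]
    field_simp

/-! ### Closed forms for the transmission and delay-time moments -/

theorem transmissionWeight_two (δ : ℝ) (n m : ℕ) :
    transmissionWeight 2 δ n m = jacobiWeight 2 (δ / 2) ((m : ℝ) - n) := by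
  funext x
  rw [transmissionWeight, jacobiWeight]
  congr 2
  ring

theorem jacobiS_eq_sum {m n k : ℕ} {δ : ℝ} (hnm : n + 1 ≤ m) (hδ : -2 < δ) (hk : 1 ≤ k) :
    jacobiS (δ / 2) ((m : ℝ) - (n + 1 : ℕ)) (n + 1) k
      = ((n + 1 : ℕ) : ℝ) * m / (δ / 2 + (n + 1 : ℕ) + m) -
          ∑ j ∈ Finset.Icc 1 (k - 1), 1 / (j : ℝ) *
            ∑ i ∈ Finset.Icc 1 (min j (n + 1)),
              (j.choose i : ℝ) * (j.choose (i - 1) : ℝ) * coeffU m (n + 1) δ i j := by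
  have ha : -1 < δ / 2 := by linarith
  have hb : 0 ≤ (m : ℝ) - (n + 1 : ℕ) := sub_nonneg.2 (by exact_mod_cast hnm)
  have hm : (m : ℝ) = (m : ℝ) - (n + 1 : ℕ) + n + 1 := by push_cast; ring
  induction k, hk using Nat.le_induction with
  | base =>
    rw [jacobiS_one n ha hb]
    simp only [Nat.sub_self, Finset.Icc_eq_empty_of_lt zero_lt_one, Finset.sum_empty, sub_zero]
    push_cast
    congr 1 <;> ring
  | succ k hk ih =>
    have hk0 : (k : ℝ) ≠ 0 := by positivity
    have h := jacobiS_succ_eq n k ha hb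
    have hsum : ∑ i ∈ Finset.Icc 1 (min k (n + 1)),
        (k.choose i : ℝ) * (k.choose (i - 1) : ℝ) * coeffU m (n + 1) δ i k
        = ∑ i ∈ Finset.range (n + 1), (δ / 2 + ((m : ℝ) - (n + 1 : ℕ)) + 2 * n + 2)
            / jacobiH n (δ / 2) ((m : ℝ) - (n + 1 : ℕ)) *
          (jacobiC (δ / 2) ((m : ℝ) - (n + 1 : ℕ)) k (n + 1) (i + 1) *
            jacobiC (δ / 2) ((m : ℝ) - (n + 1 : ℕ)) k n i *
            jacobiH (n - i) (δ / 2) ((m : ℝ) - (n + 1 : ℕ) + k)) := by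
      -- The range can be extended to all `i ≤ n + 1`, since `choose k i = 0` for `i > k`.
      have hsub : Finset.Icc 1 (min k (n + 1)) ⊆ Finset.Ico 1 (n + 1 + 1) := by
        intro i
        simp only [Finset.mem_Icc, Finset.mem_Ico]
        omega
      rw [Finset.sum_subset hsub, Finset.sum_Ico_eq_sum_range]
      · refine Finset.sum_congr rfl fun i hi => ?_
        rw [Finset.mem_range] at hi
        rw [add_comm 1 i, Nat.add_sub_cancel]
        rcases lt_or_ge i k with hik | hik
        · exact (coeffU_eq ha hb rfl hm (by omega) hik).symm
        · simp [jacobiC, Nat.choose_eq_zero_of_lt (by omega : k < i + 1)]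
      · intro i hi hi'
        simp only [Finset.mem_Icc, Finset.mem_Ico] at hi hi'
        rw [Nat.choose_eq_zero_of_lt (by omega)]
        simp
    rw [← hsum] at h
    obtain ⟨l, rfl⟩ : ∃ l, k = l + 1 := ⟨k - 1, by omega⟩
    rw [Nat.add_sub_cancel, Finset.sum_Icc_succ_top (by omega), ← sub_sub]
    rw [Nat.add_sub_cancel] at ih
    rw [← ih, ← h]
    field_simp
    ring

theorem delay_scale {n : ℕ} (hn : 1 ≤ n) (k : ℤ)
    (hE : MomentExists 2 (laguerreWeight 2 n) (Set.Ici 0) k n) :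
    MomentExists 2 (inverseDelayWeight 2 n) (Set.Ici 0) k n ∧
      ensembleMoment 2 (inverseDelayWeight 2 n) (Set.Ici 0) k n
        = (n : ℝ) ^ (-k) * laguerreMoment 2 n k n := by
  have hn' : (0 : ℝ) < n := by exact_mod_cast hn
  -- The dilation is `r = n` with `c = n^(-n)`, because `x^n e^{-nx} = n^(-n) (n x)^n e^{-nx}`.
  refine ensembleMoment_scale hn' (inv_pos.2 (pow_pos hn' n)) (fun x => ?_) measurableSet_Ici
    (fun x hx => ?_) k n hE
  · simp only [Set.mem_Ici]
    exact mul_nonneg_iff_of_pos_left hn'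
  · rw [laguerreWeight_two, inverseDelayWeight]
    simp only
    rw [Real.mul_rpow hn'.le hx, Real.rpow_natCast, mul_div_cancel_right₀ (n : ℝ) two_ne_zero,
      show (2 : ℝ) * n * x / 2 = n * x by ring]
    field_simp

theorem laguerreMoment_eq {n k : ℕ} (hk : 1 ≤ k) (hkn : k < n + 1 + 1) :
    MomentExists 2 (laguerreWeight 2 (n + 1 : ℕ)) (Set.Ici 0) (-(k : ℤ)) (n + 1) ∧
    laguerreMoment 2 (n + 1 : ℕ) (-(k : ℤ)) (n + 1) = 1 / k *
      ∑ j ∈ Finset.range (n + 1),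
        ((k + j - 1).choose (k - 1) : ℝ) * ((k + j).choose (k - 1) : ℝ) *
          (poch (2 * (n + 1 : ℕ)) (-(k : ℝ) - j) / poch (((n + 1 : ℕ) : ℝ) + 1) (-(j : ℝ) - 1)) := by
  -- The shifted Laguerre parameter is `b = (n + 1) - k`; the bound on `k` keeps it nonnegative, so
  -- the negative moment converges.
  have hb : (0 : ℝ) ≤ (n + 1 : ℕ) - k := sub_nonneg.2 (by exact_mod_cast (by omega : k ≤ n + 1))
  have hk0 : (k : ℝ) ≠ 0 := by positivity
  obtain ⟨h1, h2⟩ := laguerre_moment hb k (n + 1)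
  rw [sub_add_cancel] at h1 h2
  refine ⟨h1, ?_⟩
  have h3 := laguerre_sum n k (by linarith : -1 < ((n + 1 : ℕ) : ℝ) - k)
  rw [sub_add_cancel] at h3
  rw [h2, one_div, eq_inv_mul_iff_mul_eq₀ hk0, h3]
  refine Finset.sum_congr rfl fun j hj => ?_
  have hjn : j ≤ n := by rw [Finset.mem_range] at hj; omega
  have c1 : (k + j - 1).choose j = (k + j - 1).choose (k - 1) := by
    rw [← Nat.choose_symm_of_eq_add (by omega : k + j - 1 = (k - 1) + j)]
  have c2 : (k + j).choose (j + 1) = (k + j).choose (k - 1) := by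
    rw [← Nat.choose_symm_of_eq_add (by omega : k + j = (k - 1) + (j + 1))]
  have g1 : Real.Gamma (((n + 1 : ℕ) : ℝ) + 1 + (-(j : ℝ) - 1)) = (n - j).factorial := by
    rw [← Real.Gamma_nat_eq_factorial, Nat.cast_sub hjn]
    congr 1; push_cast; ring
  have f1 : ((n - j).factorial : ℝ) ≠ 0 := by positivity
  rw [c1, c2, poch, poch, g1, Real.Gamma_nat_eq_factorial,
    show ((n + 1 : ℕ) : ℝ) - k + n - j + 1 = 2 * (n + 1 : ℕ) + (-(k : ℝ) - j) by push_cast; ring,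
    show ((n + 1 : ℕ) : ℝ) + n + 1 = 2 * (n + 1 : ℕ) by push_cast; ring]
  field_simp

end QuantumTransport

theorem theorem2p1 (n : ℕ) (hn : 1 ≤ n) :
    (∀ (m k : ℕ) (δ : ℝ), n ≤ m → 1 ≤ k → -2 < δ →
      QuantumTransport.MomentExists 2 (QuantumTransport.transmissionWeight 2 δ n m)
        (Set.Icc 0 1) k n ∧
      QuantumTransport.transmissionMoment 2 δ k n m =
        QuantumTransport.jacobiMoment 2 (δ / 2) ((m : ℝ) - n) k n ∧
      QuantumTransport.transmissionMoment 2 δ k n m =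
        (n : ℝ) * m / (δ / 2 + n + m) -
          ∑ j ∈ Finset.Icc 1 (k - 1), 1 / (j : ℝ) *
            ∑ i ∈ Finset.Icc 1 (min j n),
              (j.choose i : ℝ) * (j.choose (i - 1) : ℝ) *
                QuantumTransport.coeffU m n δ i j) ∧
    (∀ k : ℕ, 1 ≤ k → k < n + 1 →
      QuantumTransport.MomentExists 2 (QuantumTransport.inverseDelayWeight 2 n)
        (Set.Ici 0) (-(k : ℤ)) n ∧
      QuantumTransport.delayMoment 2 k n =
        (n : ℝ) ^ (k - 1) * QuantumTransport.laguerreMoment 2 n (-(k : ℤ)) n ∧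
      QuantumTransport.delayMoment 2 k n =
        (n : ℝ) ^ (k - 1) / k *
          ∑ j ∈ Finset.range n,
            ((k + j - 1).choose (k - 1) : ℝ) * ((k + j).choose (k - 1) : ℝ) *
              (QuantumTransport.poch (2 * n) (-(k : ℝ) - j) /
                QuantumTransport.poch ((n : ℝ) + 1) (-(j : ℝ) - 1))) := by
  obtain ⟨N, rfl⟩ : ∃ N, n = N + 1 := ⟨n - 1, by omega⟩
  refine ⟨fun m k δ hnm hk hδ => ?_, fun k hk hkn => ?_⟩
  · have ha : -1 < δ / 2 := by linarith
    have hb : 0 ≤ (m : ℝ) - (N + 1 : ℕ) := sub_nonneg.2 (by exact_mod_cast hnm)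
    obtain ⟨h1, h2⟩ := QuantumTransport.jacobi_moment ha hb k (N + 1)
    have h3 : QuantumTransport.transmissionMoment 2 δ k (N + 1) m
        = QuantumTransport.jacobiMoment 2 (δ / 2) ((m : ℝ) - (N + 1 : ℕ)) k (N + 1) := by
      rw [QuantumTransport.transmissionMoment, QuantumTransport.transmissionWeight_two,
        QuantumTransport.jacobiMoment]
    rw [QuantumTransport.transmissionWeight_two]
    exact ⟨h1, h3, by rw [h3, h2, QuantumTransport.jacobiS_eq_sum hnm hδ hk]⟩
  · obtain ⟨h1, h2⟩ := QuantumTransport.laguerreMoment_eq hk hkn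
    obtain ⟨h3, h4⟩ := QuantumTransport.delay_scale hn (-(k : ℤ)) h1
    have h5 : QuantumTransport.delayMoment 2 k (N + 1) = ((N + 1 : ℕ) : ℝ) ^ (k - 1) *
        QuantumTransport.laguerreMoment 2 (N + 1 : ℕ) (-(k : ℤ)) (N + 1) := by
      -- The dilation contributes `n ^ k` and the average over delay times `1 / n`; writing `k = l +
      -- 1` avoids the truncated `k - 1`.
      obtain ⟨l, rfl⟩ : ∃ l, k = l + 1 := ⟨k - 1, by omega⟩
      have hN : ((N + 1 : ℕ) : ℝ) ≠ 0 := by positivity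
      rw [QuantumTransport.delayMoment, h4, neg_neg, zpow_natCast, Nat.add_sub_cancel, pow_succ]
      field_simp
    exact ⟨h3, h5, by rw [h5, h2]; ring⟩
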